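/- Let $A$ be a unital C*-algebra, let $G$ be a discrete group with identity $e$, and let $(\alpha,\sigma)$ be a twisted action of $G$ on $A$: maps $\alpha: G\to \mathrm{Aut}(A)$ and $\sigma: G\times G\to \mathcal U(A)$ such that, for all $g,h,k\in G$, $$\alpha_g\circ\alpha_h=\mathrm{Ad}(\sigma(g,h))\circ\alpha_{gh},\qquad \sigma(g,h)\,\sigma(gh,k)=\alpha_g(\sigma(h,k))\,\sigma(g,hk),\qquad \sigma(g,e)=\sigma(e,g)=1.$$ Put $\Sigma=(A,G,\alpha,\sigma)$. The reduced crossed product $C_r^*(\Sigma)$ is the C*-algebra generated by the operators $(\pi(a)\xi)(h)=\alpha_{h^{-1}}(a)\xi(h)$ and $(\lambda(g)\xi)(h)=\sigma(h^{-1},g)\xi(g^{-1}h)$ ($a\in A$, $g\in G$) on $\ell^2(G,\mathcal H)$, where $A$ acts faithfully on the Hilbert space $\mathcal H$; up to isomorphism it does not depend on the choice of $\mathcal H$, and $A$ is identified with $\pi(A)$. "Ideal" means closed two-sided ideal, and for an ideal $J$ of $A$, $\langle J\rangle$ denotes the ideal of $C_r^*(\Sigma)$ generated by $J$. An ideal $J$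 of $A$ is invariant if $\alpha_g(J)=J$ for all $g\in G$; then $\Sigma/J$ denotes the induced system on $A/J$. The system $\Sigma$ is exact if, for every invariant ideal $J$ of $A$, the kernel of the canonical *-homomorphism $C_r^*(\Sigma)\to C_r^*(\Sigma/J)$ is $\langle J\rangle$. The class $\mathcal P$ consists of the PH groups and the groups with property $(P_{\rm com})$, which are defined as follows. (PH) For a set $M\subset G\setminus\{e\}$, a set $T\subset G$ is $M$-large if $m(G\setminus T)\subset T$ for all $m\in M$. For a non-empty set $F\subset G\setminus\{e\}$, a set $H\subset G$ is a Powers set for $F$ if for every $N\in\mathbb N$ there are $h_1,\dots,h_N\in H$ and pairwise disjoint $T_1,\dots,T_N\subset G$ such that $T_j$ is $h_jFh_j^{-1}$-large for each $j$. For $g\neq e$, $H$ is a c-Powers set for $g$ if it is a Powers set for $\{aga^{-1}: a\in M\}$ for every finite non-empty $M\subset H$. The group $G$ is a PH group if every finite non-empty $F\subset G\setminus\{e\}$ can be written as $F=\{f_1,\dots,f_n\}$ so that there is a chain of subgroups $G_1\subset\dots\subset G_n\subset G$ with $G_j$ a c-Powers set for $f_j$, $j=1,\dots,n$. ($P_{\rm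 com}$) For every finite non-empty $F\subset G\setminus\{e\}$ there are $n\in\mathbb N$, $g_0\in G$ and $U,D_1,\dots,D_n\subset G$ such that $G\setminus U\subset D_1\cup\dots\cup D_n$; $gU\cap U=\emptyset$ for all $g\in F$; and $g_0^{-j}D_k\cap D_k=\emptyset$ for all $j\ge 1$ and $k=1,\dots,n$. **Proposition.** Assume that $\alpha$ is trivial (that is, $\alpha_g=\mathrm{id}_A$ for all $g\in G$), that $\Sigma$ is exact and that $G\in\mathcal P$. Then $J\mapsto\langle J\rangle$ is a bijection from the set of all ideals of $A$ onto the set of all ideals of $C_r^*(\Sigma)$. -/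

import Mathlib

universe u v

noncomputable section

/-- A closed two-sided ideal of a topological ring. -/
structure ClosedIdeal (R : Type u) [Ring R] [TopologicalSpace R] where
  toIdeal : Ideal R
  isTwoSided : toIdeal.IsTwoSided
  isClosed : IsClosed (toIdeal : Set R)

namespace ClosedIdeal

section Basic

variable {R : Type u} [Ring R] [TopologicalSpace R]

instance : SetLike (ClosedIdeal R) R where
  coe J := J.toIdeal
  coe_injective I J h := by
    cases I; cases J; congr; exact SetLike.coe_injective h

theorem mem_toIdeal {J : ClosedIdeal R} {a : R} : a ∈ J.toIdeal ↔ a ∈ J := Iff.rfl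

instance (J : ClosedIdeal R) : J.toIdeal.IsTwoSided := J.isTwoSided

theorem mul_mem_left (J : ClosedIdeal R) (a : R) {b : R} (hb : b ∈ J) : a * b ∈ J :=
  J.toIdeal.mul_mem_left a hb

theorem mul_mem_right (J : ClosedIdeal R) {a : R} (b : R) (ha : a ∈ J) : a * b ∈ J :=
  J.toIdeal.mul_mem_right b ha

/-- The closed two-sided ideal generated by a set: the smallest one containing it. -/
def span (s : Set R) : ClosedIdeal R where
  toIdeal := sInf {I : Ideal R | I.IsTwoSided ∧ IsClosed (I : Set R) ∧ s ⊆ I}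
  isTwoSided := ⟨fun b ha => by
    rw [Ideal.mem_sInf] at ha ⊢
    intro I hI
    have := hI.1
    exact I.mul_mem_right b (ha hI)⟩
  isClosed := by
    rw [Submodule.coe_sInf]
    exact isClosed_biInter fun I hI => hI.2.1

end Basic

section CStar

variable {A : Type u} [CStarAlgebra A]

theorem exists_local_unit (J : ClosedIdeal A) {k : A} (hk : k ∈ J)
    (hs : IsSelfAdjoint k) {δ : ℝ} (hδ : 0 < δ) :
    ∃ e ∈ J, IsSelfAdjoint e ∧ ‖1 - e‖ ≤ 1 ∧ ‖k * (1 - e)‖ ≤ δ := by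
  have hpos : ∀ t : ℝ, 0 < t ^ 2 + δ ^ 2 := fun t => by positivity
  have hc1 : Continuous fun t : ℝ => t / (t ^ 2 + δ ^ 2) :=
    continuous_id.div (by fun_prop) fun t => (hpos t).ne'
  have hc2 : Continuous fun t : ℝ => t ^ 2 / (t ^ 2 + δ ^ 2) :=
    Continuous.div (by fun_prop) (by fun_prop) fun t => (hpos t).ne'
  have h1e : 1 - cfc (fun t : ℝ => t ^ 2 / (t ^ 2 + δ ^ 2)) k
      = cfc (fun t : ℝ => δ ^ 2 / (t ^ 2 + δ ^ 2)) k := by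
    rw [← cfc_const_one ℝ k, ← cfc_sub _ _ k (by fun_prop) hc2.continuousOn]
    refine cfc_congr fun t _ => ?_
    have := (hpos t).ne'
    field_simp
    ring
  have hc3 : Continuous fun t : ℝ => δ ^ 2 / (t ^ 2 + δ ^ 2) :=
    Continuous.div (by fun_prop) (by fun_prop) fun t => (hpos t).ne'
  refine ⟨cfc (fun t : ℝ => t ^ 2 / (t ^ 2 + δ ^ 2)) k, ?_, cfc_predicate _ _, ?_, ?_⟩
  · have : cfc (fun t : ℝ => t ^ 2 / (t ^ 2 + δ ^ 2)) k
        = k * cfc (fun t : ℝ => t / (t ^ 2 + δ ^ 2)) k := by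
      conv_rhs => rw [← cfc_id ℝ k]
      rw [cfc_id ℝ k]
      nth_rw 2 [← cfc_id ℝ k]
      rw [← cfc_mul _ _ k (by fun_prop) hc1.continuousOn]
      refine cfc_congr fun t _ => ?_
      simp only [id]
      ring
    rw [this]
    exact J.mul_mem_right _ hk
  · rw [h1e]
    refine norm_cfc_le zero_le_one fun t _ => ?_
    rw [Real.norm_of_nonneg (by have := hpos t; positivity), div_le_one (hpos t)]
    nlinarith [sq_nonneg t]
  · rw [h1e]
    nth_rw 1 [← cfc_id ℝ k]
    rw [← cfc_mul _ _ k (by fun_prop) hc3.continuousOn]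
    refine norm_cfc_le hδ.le fun t _ => ?_
    simp only [id]
    rw [Real.norm_eq_abs, abs_mul, abs_of_pos (div_pos (pow_pos hδ 2) (hpos t)), ← mul_div_assoc,
      div_le_iff₀ (hpos t)]
    nlinarith [sq_nonneg (|t| - δ), sq_abs t, abs_nonneg t]

theorem star_mem (J : ClosedIdeal A) {a : A} (ha : a ∈ J) : star a ∈ J := by
  have hcl := J.isClosed
  rw [← SetLike.mem_coe, show ((J : Set A)) = closure (J : Set A) from hcl.closure_eq.symm,
    Metric.mem_closure_iff]
  intro ε hε
  obtain ⟨e, heJ, hes, he1, he2⟩ := J.exists_local_unit (J.mul_mem_right (star a) ha)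
    (IsSelfAdjoint.mul_star_self a) (δ := (ε / 2) ^ 2) (by positivity)
  refine ⟨star a * e, J.mul_mem_left _ heJ, ?_⟩
  rw [dist_eq_norm]
  have h1 : star a - star a * e = star a * (1 - e) := by noncomm_ring
  have h2 : ‖star a * (1 - e)‖ * ‖star a * (1 - e)‖ ≤ (ε / 2) ^ 2 := by
    rw [← CStarRing.norm_star_mul_self]
    have : star (star a * (1 - e)) * (star a * (1 - e)) = (1 - e) * (a * star a * (1 - e)) := by
      simp only [star_mul, star_star, star_sub, star_one, hes.star_eq]
      noncomm_ring
    rw [this]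
    calc _ ≤ ‖1 - e‖ * ‖a * star a * (1 - e)‖ := norm_mul_le _ _
      _ ≤ 1 * (ε / 2) ^ 2 := by gcongr
      _ = _ := one_mul _
  rw [h1]
  nlinarith [norm_nonneg (star a * (1 - e))]

/-- The quotient C*-algebra by a closed two-sided ideal. -/
def Quot (J : ClosedIdeal A) : Type u := A ⧸ J.toIdeal

variable (J : ClosedIdeal A)

section QuotStructure

local instance quotNormedRing : NormedRing J.Quot :=
  letI : IsClosed (J.toIdeal : Set A) := J.isClosed
  letI : NormedAddCommGroup J.Quot := Submodule.Quotient.normedAddCommGroup J.toIdeal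
  { Ideal.Quotient.ring J.toIdeal, Submodule.Quotient.normedAddCommGroup J.toIdeal with
    norm_mul_le := fun x y => by
      refine le_of_forall_pos_le_add fun ε hε => ?_
      have hc : Filter.Tendsto (fun δ : ℝ => (‖x‖ + δ) * (‖y‖ + δ)) (nhdsWithin 0 (Set.Ioi 0))
          (nhds ((‖x‖ + 0) * (‖y‖ + 0))) :=
        (Continuous.tendsto (by fun_prop) 0).mono_left nhdsWithin_le_nhds
      simp only [add_zero] at hc
      obtain ⟨δ, hδ, hδ0⟩ := ((hc.eventually (gt_mem_nhds (lt_add_of_pos_right _ hε))).and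
        self_mem_nhdsWithin).exists
      obtain ⟨a, rfl, ha⟩ := Submodule.Quotient.norm_mk_lt (S := J.toIdeal) x hδ0
      obtain ⟨b, rfl, hb⟩ := Submodule.Quotient.norm_mk_lt (S := J.toIdeal) y hδ0
      calc _ ≤ ‖a * b‖ := Submodule.Quotient.norm_mk_le J.toIdeal (a * b)
        _ ≤ ‖a‖ * ‖b‖ := norm_mul_le _ _
        _ ≤ _ := mul_le_mul ha.le hb.le (norm_nonneg _) ((norm_nonneg _).trans ha.le)
        _ ≤ _ := hδ.le }

/-- The quotient map, as a ring homomorphism. -/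
def mkRingHom : A →+* J.Quot := Ideal.Quotient.mk J.toIdeal

theorem mkRingHom_surjective : Function.Surjective J.mkRingHom := Ideal.Quotient.mk_surjective

theorem mkRingHom_eq_zero_iff {a : A} : J.mkRingHom a = 0 ↔ a ∈ J := Ideal.Quotient.eq_zero_iff_mem

theorem mkRingHom_eq_iff {a b : A} : J.mkRingHom a = J.mkRingHom b ↔ a - b ∈ J :=
  Ideal.Quotient.eq

theorem norm_mk_le (a : A) : ‖J.mkRingHom a‖ ≤ ‖a‖ := Submodule.Quotient.norm_mk_le J.toIdeal a

theorem exists_norm_lt (x : J.Quot) {ε : ℝ} (hε : 0 < ε) :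
    ∃ a, J.mkRingHom a = x ∧ ‖a‖ < ‖x‖ + ε :=
  Submodule.Quotient.norm_mk_lt (S := J.toIdeal) x hε

local instance quotCompleteSpace : CompleteSpace J.Quot := Submodule.Quotient.completeSpace J.toIdeal

local instance quotAlgebra : Algebra ℂ J.Quot := Ideal.Quotient.algebra ℂ (I := J.toIdeal)

theorem mkRingHom_smul (c : ℂ) (a : A) : J.mkRingHom (c • a) = c • J.mkRingHom a := rfl

local instance quotNormedAlgebra : NormedAlgebra ℂ J.Quot where
  norm_smul_le c x := by
    refine le_of_forall_pos_le_add fun ε hε => ?_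
    obtain ⟨a, rfl, ha⟩ := J.exists_norm_lt x (ε := ε / (‖c‖ + 1)) (by positivity)
    calc ‖c • J.mkRingHom a‖ = ‖J.mkRingHom (c • a)‖ := rfl
      _ ≤ ‖c • a‖ := J.norm_mk_le _
      _ = ‖c‖ * ‖a‖ := norm_smul _ _
      _ ≤ ‖c‖ * (‖J.mkRingHom a‖ + ε / (‖c‖ + 1)) := by gcongr
      _ = ‖c‖ * ‖J.mkRingHom a‖ + ε * (‖c‖ / (‖c‖ + 1)) := by ring
      _ ≤ ‖c‖ * ‖J.mkRingHom a‖ + ε * 1 := by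
        gcongr
        rw [div_le_one (by positivity)]
        linarith
      _ = _ := by rw [mul_one]

local instance quotStar : Star J.Quot where
  star := Quotient.map' star fun a b h => by
    have h' : a - b ∈ J := (Submodule.quotientRel_def J.toIdeal).1 h
    refine (Submodule.quotientRel_def J.toIdeal).2 ?_
    rw [← star_sub]
    exact J.star_mem h'

theorem star_mkRingHom (a : A) : star (J.mkRingHom a) = J.mkRingHom (star a) := rfl

local instance quotStarRing : StarRing J.Quot where
  star_involutive x := by
    obtain ⟨a, rfl⟩ := J.mkRingHom_surjective x
    simp only [star_mkRingHom, star_star]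
  star_mul x y := by
    obtain ⟨a, rfl⟩ := J.mkRingHom_surjective x
    obtain ⟨b, rfl⟩ := J.mkRingHom_surjective y
    simp only [star_mkRingHom, ← map_mul, star_mul]
  star_add x y := by
    obtain ⟨a, rfl⟩ := J.mkRingHom_surjective x
    obtain ⟨b, rfl⟩ := J.mkRingHom_surjective y
    simp only [star_mkRingHom, ← map_add, star_add]

local instance quotStarModule : StarModule ℂ J.Quot where
  star_smul c x := by
    obtain ⟨a, rfl⟩ := J.mkRingHom_surjective x
    simp only [star_mkRingHom, ← mkRingHom_smul, star_smul]

theorem norm_mul_self_le_aux (a : A) :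
    ‖J.mkRingHom a‖ * ‖J.mkRingHom a‖ ≤ ‖J.mkRingHom (star a * a)‖ := by
  refine le_of_forall_pos_le_add fun ε hε => ?_
  obtain ⟨c, hc, hcn⟩ := J.exists_norm_lt (J.mkRingHom (star a * a)) (half_pos hε)
  rw [mkRingHom_eq_iff] at hc
  -- a self-adjoint representative of the class of `star a * a`
  set d : A := (2 : ℂ)⁻¹ • (c + star c) with hd
  have hdn : ‖d‖ ≤ ‖c‖ := by
    rw [hd, norm_smul]
    have := norm_add_le c (star c)
    rw [norm_star] at this
    norm_num
    linarith
  have hds : IsSelfAdjoint d := by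
    rw [isSelfAdjoint_iff, hd, star_smul, star_add, star_star, add_comm (star c)]
    norm_num
  have hk : d - star a * a ∈ J := by
    have h1 : d - star a * a
        = algebraMap ℂ A (2 : ℂ)⁻¹ * ((c - star a * a) + star (c - star a * a)) := by
      rw [← Algebra.smul_def, hd, star_sub, star_mul, star_star,
        show c - star a * a + (star c - star a * a) = (c + star c) - (2 : ℂ) • (star a * a) by
          rw [two_smul]; abel, smul_sub, smul_smul]
      norm_num
    rw [h1]
    exact J.mul_mem_left _ (J.toIdeal.add_mem hc (J.star_mem hc))
  have hks : IsSelfAdjoint (d - star a * a) := hds.sub (IsSelfAdjoint.star_mul_self a)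
  obtain ⟨e, heJ, hes, he1, he2⟩ := J.exists_local_unit hk hks (half_pos hε)
  have h1 : ‖J.mkRingHom a‖ ≤ ‖a * (1 - e)‖ := by
    have : J.mkRingHom a = J.mkRingHom (a * (1 - e)) := by
      rw [mkRingHom_eq_iff]
      have : a - a * (1 - e) = a * e := by noncomm_ring
      rw [this]
      exact J.mul_mem_left _ heJ
    rw [this]
    exact J.norm_mk_le _
  have h2 : ‖a * (1 - e)‖ * ‖a * (1 - e)‖ ≤ ‖d‖ + ε / 2 := by
    rw [← CStarRing.norm_star_mul_self]
    have : star (a * (1 - e)) * (a * (1 - e))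
        = (1 - e) * d * (1 - e) - (1 - e) * ((d - star a * a) * (1 - e)) := by
      simp only [star_mul, star_sub, star_one, hes.star_eq]
      noncomm_ring
    rw [this]
    calc _ ≤ ‖(1 - e) * d * (1 - e)‖ + ‖(1 - e) * ((d - star a * a) * (1 - e))‖ := norm_sub_le _ _
      _ ≤ ‖1 - e‖ * ‖d‖ * ‖1 - e‖ + ‖1 - e‖ * ‖(d - star a * a) * (1 - e)‖ := by
        gcongr
        · exact norm_mul₃_le
        · exact norm_mul_le _ _
      _ ≤ 1 * ‖d‖ * 1 + 1 * (ε / 2) := by gcongr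
      _ = _ := by ring
  calc ‖J.mkRingHom a‖ * ‖J.mkRingHom a‖ ≤ ‖a * (1 - e)‖ * ‖a * (1 - e)‖ := by gcongr
    _ ≤ ‖d‖ + ε / 2 := h2
    _ ≤ _ := by linarith

local instance quotCStarRing : CStarRing J.Quot where
  norm_mul_self_le x := by
    obtain ⟨a, rfl⟩ := J.mkRingHom_surjective x
    rw [star_mkRingHom, ← map_mul]
    exact J.norm_mul_self_le_aux a

/-- The C*-algebra structure of the quotient. -/
def quotCStarAlgebra : CStarAlgebra J.Quot :=
  { (inferInstance : NormedRing J.Quot), (inferInstance : StarRing J.Quot),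
    (inferInstance : NormedAlgebra ℂ J.Quot) with
    norm_mul_self_le := CStarRing.norm_mul_self_le
    complete := CompleteSpace.complete
    star_smul := star_smul }

end QuotStructure

instance : CStarAlgebra J.Quot := J.quotCStarAlgebra

/-- The quotient map `A → A / J`. -/
def quotMap : A →⋆ₐ[ℂ] J.Quot where
  __ := J.mkRingHom
  commutes' _ := rfl
  map_star' _ := rfl

theorem quotMap_surjective : Function.Surjective J.quotMap := J.mkRingHom_surjective

theorem quotMap_eq_zero_iff {a : A} : J.quotMap a = 0 ↔ a ∈ J := J.mkRingHom_eq_zero_iff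

theorem quotMap_eq_iff {a b : A} : J.quotMap a = J.quotMap b ↔ a - b ∈ J := J.mkRingHom_eq_iff

end CStar

end ClosedIdeal

/-! ### Operators on Hilbert sums -/

section Operators

open scoped InnerProductSpace

variable {ι : Type*} {κ : Type*} {H : κ → Type*} {K : ι → Type*}
  [∀ k, NormedAddCommGroup (H k)] [∀ k, InnerProductSpace ℂ (H k)]
  [∀ i, NormedAddCommGroup (K i)] [∀ i, InnerProductSpace ℂ (K i)]

theorem weightedComp_summable {e : ι → κ} (he : Function.Injective e)
    {c : ∀ i, H (e i) →L[ℂ] K i} {C : ℝ} (hc : ∀ i, ‖c i‖ ≤ C) (ξ : lp H 2) :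
    Summable (fun i => ‖c i (ξ (e i))‖ ^ 2) ∧
      ∑' i, ‖c i (ξ (e i))‖ ^ 2 ≤ C ^ 2 * ‖ξ‖ ^ 2 := by
  have h2 : (0 : ℝ) < (2 : ENNReal).toReal := by norm_num
  have hs : Summable fun k => ‖ξ k‖ ^ 2 := by simpa using (lp.memℓp ξ).summable h2
  have hn : ‖ξ‖ ^ 2 = ∑' k, ‖ξ k‖ ^ 2 := by simpa using lp.norm_rpow_eq_tsum h2 ξ
  have hb : ∀ i, ‖c i (ξ (e i))‖ ^ 2 ≤ C ^ 2 * ‖ξ (e i)‖ ^ 2 := fun i => by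
    rw [← mul_pow]
    exact pow_le_pow_left₀ (norm_nonneg _)
      ((c i).le_of_opNorm_le (hc i) _) 2
  have hs' : Summable fun i => ‖ξ (e i)‖ ^ 2 := hs.comp_injective he
  have hs'' : Summable fun i => ‖c i (ξ (e i))‖ ^ 2 :=
    Summable.of_nonneg_of_le (fun i => by positivity) hb (hs'.mul_left _)
  refine ⟨hs'', ?_⟩
  calc _ ≤ ∑' i, C ^ 2 * ‖ξ (e i)‖ ^ 2 := hs''.tsum_le_tsum hb (hs'.mul_left _)
    _ = C ^ 2 * ∑' i, ‖ξ (e i)‖ ^ 2 := tsum_mul_left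
    _ ≤ C ^ 2 * ‖ξ‖ ^ 2 := by
      rw [hn]
      gcongr
      exact hs'.tsum_le_tsum_of_inj e he (fun _ _ => by positivity) (fun _ => le_rfl) hs

/-- The bounded operator `(T ξ)(i) = c i (ξ (e i))` between Hilbert sums, where `e` is an injective
map of the index sets and `c` is a bounded family of operators. -/
def weightedComp (e : ι → κ) (he : Function.Injective e) (c : ∀ i, H (e i) →L[ℂ] K i)
    (C : ℝ) (hC : 0 ≤ C) (hc : ∀ i, ‖c i‖ ≤ C) : lp H 2 →L[ℂ] lp K 2 :=
  LinearMap.mkContinuous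
    { toFun := fun ξ => ⟨fun i => c i (ξ (e i)), memℓp_gen (by
        simpa using (weightedComp_summable he hc ξ).1)⟩
      map_add' := fun ξ η => by ext i; simp only [lp.coeFn_add, Pi.add_apply, map_add]
      map_smul' := fun z ξ => by ext i; simp }
    C fun ξ => by
      have h2 : (0 : ℝ) < (2 : ENNReal).toReal := by norm_num
      refine lp.norm_le_of_tsum_le h2 (by positivity) ?_
      have := (weightedComp_summable he hc ξ).2
      rw [← mul_pow] at this
      simpa using this

@[simp]
theorem weightedComp_apply (e : ι → κ) (he : Function.Injective e) (c : ∀ i, H (e i) →L[ℂ] K i)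
    (C : ℝ) (hC : 0 ≤ C) (hc : ∀ i, ‖c i‖ ≤ C) (ξ : lp H 2) (i : ι) :
    weightedComp e he c C hC hc ξ i = c i (ξ (e i)) := rfl

end Operators

/-! ### The universal representation -/

section Universal

attribute [local instance 50] CStarAlgebra.spectralOrder CStarAlgebra.spectralOrderedRing

open scoped ComplexOrder

/-- The positive linear functionals on a C*-algebra. -/
abbrev PosFunctional (A : Type u) [CStarAlgebra A] : Type u := A →ₚ[ℂ] ℂ

/-- The Hilbert space of the universal representation: the Hilbert sum of the GNS spaces of all
positive linear functionals. -/
def UnivSpace (A : Type u) [CStarAlgebra A] : Type u :=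
  lp (fun f : PosFunctional A => f.GNS) 2

instance (A : Type u) [CStarAlgebra A] : NormedAddCommGroup (UnivSpace A) :=
  inferInstanceAs (NormedAddCommGroup (lp (fun f : PosFunctional A => f.GNS) 2))

instance (A : Type u) [CStarAlgebra A] : InnerProductSpace ℂ (UnivSpace A) :=
  inferInstanceAs (InnerProductSpace ℂ (lp (fun f : PosFunctional A => f.GNS) 2))

instance (A : Type u) [CStarAlgebra A] : CompleteSpace (UnivSpace A) :=
  inferInstanceAs (CompleteSpace (lp (fun f : PosFunctional A => f.GNS) 2))

/-- The direct sum of the GNS representations, on the Hilbert sum of the GNS spaces. -/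
def sumRep (A : Type u) [CStarAlgebra A] : A →⋆ₐ[ℂ]
    (lp (fun f : PosFunctional A => f.GNS) 2 →L[ℂ] lp (fun f : PosFunctional A => f.GNS) 2) where
  toFun a := weightedComp id Function.injective_id (fun f => f.gnsStarAlgHom a) ‖a‖ (norm_nonneg a)
    fun f => NonUnitalStarAlgHom.norm_apply_le f.gnsStarAlgHom a
  map_one' := by ext ξ f; simp
  map_mul' a b := by ext ξ f; simp
  map_zero' := by ext ξ f; simp
  map_add' a b := by ext ξ f; simp
  commutes' z := by
    ext ξ f
    rw [weightedComp_apply, AlgHomClass.commutes]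
    simp [Algebra.algebraMap_eq_smul_one]
  map_star' a := by
    refine (ContinuousLinearMap.eq_adjoint_iff _ _).2 fun ξ η => ?_
    rw [lp.inner_eq_tsum, lp.inner_eq_tsum]
    refine tsum_congr fun f => ?_
    simp only [weightedComp_apply, id, map_star, ContinuousLinearMap.star_eq_adjoint,
      ContinuousLinearMap.adjoint_inner_left]

/-- The universal representation: the direct sum of the GNS representations of all positive
linear functionals. By the Gelfand-Naimark theorem it is a faithful representation of `A` on a
Hilbert space. -/
def univRep (A : Type u) [CStarAlgebra A] : A →⋆ₐ[ℂ] (UnivSpace A →L[ℂ] UnivSpace A) :=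
  sumRep A

/-! ### Twisted C*-dynamical systems and their reduced crossed products -/

/-- A twisted, unital, discrete C*-dynamical system `Σ = (A, G, α, σ)`: maps `α : G → Aut(A)` and
`σ : G × G → U(A)` with `α_g ∘ α_h = Ad(σ(g, h)) ∘ α_{gh}`,
`σ(g, h) σ(gh, k) = α_g(σ(h, k)) σ(g, hk)` and `σ(g, e) = σ(e, g) = 1`. -/
structure TwistedSystem (A : Type u) (G : Type v) [CStarAlgebra A] [Group G] where
  α : G → (A ≃⋆ₐ[ℂ] A)
  σ : G → G → unitary A
  α_comp : ∀ g h a, α g (α h a) = (σ g h : A) * α (g * h) a * star (σ g h : A)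
  cocycle : ∀ g h k, (σ g h : A) * (σ (g * h) k : A) = α g (σ h k : A) * (σ g (h * k) : A)
  σ_one_right : ∀ g, σ g 1 = 1
  σ_one_left : ∀ g, σ 1 g = 1

/-- The Hilbert space `ℓ²(G, K)`. -/
abbrev EllTwo (G : Type v) (K : Type u) [NormedAddCommGroup K] [InnerProductSpace ℂ K] :
    Type (max v u) :=
  lp (fun _ : G => K) 2

theorem norm_unitary_le_one {A : Type u} [CStarAlgebra A] (w : unitary A) : ‖(w : A)‖ ≤ 1 := by
  nontriviality A
  exact (CStarRing.norm_coe_unitary w).le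

namespace TwistedSystem

section CrossedProduct

variable {A : Type u} {G : Type v} [CStarAlgebra A] [Group G] (S : TwistedSystem A G)

/-- The regular representation of `A` on `ℓ²(G, H)`, where `H` is the universal representation
space of `A`: `(π(a) ξ)(h) = α_{h⁻¹}(a) ξ(h)`. -/
def regA (a : A) : EllTwo G (UnivSpace A) →L[ℂ] EllTwo G (UnivSpace A) :=
  weightedComp id Function.injective_id (fun h : G => univRep A (S.α h⁻¹ a)) ‖a‖ (norm_nonneg a)
    fun h => (NonUnitalStarAlgHom.norm_apply_le (univRep A) _).trans
      (NonUnitalStarAlgHom.norm_apply_le (S.α h⁻¹ : A →⋆ₐ[ℂ] A) a)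

/-- The unitaries of the regular representation: `(λ(g) ξ)(h) = σ(h⁻¹, g) ξ(g⁻¹ h)`. -/
def regG (g : G) : EllTwo G (UnivSpace A) →L[ℂ] EllTwo G (UnivSpace A) :=
  weightedComp (fun h : G => g⁻¹ * h) (mul_right_injective g⁻¹)
    (fun h : G => univRep A (S.σ h⁻¹ g : A)) 1 zero_le_one
    fun _ => (NonUnitalStarAlgHom.norm_apply_le (univRep A) _).trans (norm_unitary_le_one _)

@[simp]
theorem regA_apply (a : A) (ξ : EllTwo G (UnivSpace A)) (h : G) :
    S.regA a ξ h = univRep A (S.α h⁻¹ a) (ξ h) := rfl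

@[simp]
theorem regG_apply (g : G) (ξ : EllTwo G (UnivSpace A)) (h : G) :
    S.regG g ξ h = univRep A (S.σ h⁻¹ g : A) (ξ (g⁻¹ * h)) := rfl

/-- The reduced crossed product `C*_r(Σ)`: the C*-algebra of operators on `ℓ²(G, H)` generated by
the regular covariant representation `(π, λ)` of the system, for `A` acting faithfully on the
universal representation space `H`. -/
def reducedCrossedProduct :
    StarSubalgebra ℂ (EllTwo G (UnivSpace A) →L[ℂ] EllTwo G (UnivSpace A)) :=
  (StarAlgebra.adjoin ℂ (Set.range S.regA ∪ Set.range S.regG)).topologicalClosure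

theorem isClosed_reducedCrossedProduct :
    IsClosed (S.reducedCrossedProduct :
      Set (EllTwo G (UnivSpace A) →L[ℂ] EllTwo G (UnivSpace A))) :=
  StarSubalgebra.isClosed_topologicalClosure _

instance : CStarAlgebra S.reducedCrossedProduct :=
  StarSubalgebra.cstarAlgebra _ (h_closed := S.isClosed_reducedCrossedProduct)

/-- The copy of `A` in the reduced crossed product. -/
def inA (a : A) : S.reducedCrossedProduct :=
  ⟨S.regA a, StarSubalgebra.le_topologicalClosure _ (StarAlgebra.subset_adjoin ℂ _ (.inl ⟨a, rfl⟩))⟩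

/-- The canonical unitaries `λ(g)` in the reduced crossed product. -/
def inG (g : G) : S.reducedCrossedProduct :=
  ⟨S.regG g, StarSubalgebra.le_topologicalClosure _ (StarAlgebra.subset_adjoin ℂ _ (.inr ⟨g, rfl⟩))⟩

/-- The ideal `⟨J⟩` of the reduced crossed product generated by an ideal `J` of `A`. -/
def inducedIdeal (J : ClosedIdeal A) : ClosedIdeal S.reducedCrossedProduct :=
  ClosedIdeal.span (S.inA '' J)

/-- An ideal `J` of `A` is invariant if `α_g(J) = J` for all `g`. -/
def IsInvariant (J : ClosedIdeal A) : Prop :=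
  ∀ g a, S.α g a ∈ J ↔ a ∈ J

end CrossedProduct

/-! ### Quotient systems and exactness -/

section Quotient

variable {A : Type u} {G : Type v} [CStarAlgebra A] [Group G] (S : TwistedSystem A G)
  {J : ClosedIdeal A}

/-- The automorphism of `A / J` induced by `α_g`. -/
def quotientAut (hJ : S.IsInvariant J) (g : G) : J.Quot ≃⋆ₐ[ℂ] J.Quot where
  toFun := Quotient.map' (S.α g) fun a b h => by
    have h' : a - b ∈ J := (Submodule.quotientRel_def J.toIdeal).1 h
    refine (Submodule.quotientRel_def J.toIdeal).2 ?_
    rw [← map_sub]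
    exact (hJ g _).2 h'
  invFun := Quotient.map' (S.α g).symm fun a b h => by
    have h' : a - b ∈ J := (Submodule.quotientRel_def J.toIdeal).1 h
    refine (Submodule.quotientRel_def J.toIdeal).2 ?_
    rw [← map_sub]
    refine (hJ g _).1 ?_
    simpa using h'
  left_inv x := by
    obtain ⟨a, rfl⟩ := J.quotMap_surjective x
    exact congrArg J.quotMap ((S.α g).symm_apply_apply a)
  right_inv x := by
    obtain ⟨a, rfl⟩ := J.quotMap_surjective x
    exact congrArg J.quotMap ((S.α g).apply_symm_apply a)
  map_mul' x y := by
    obtain ⟨a, rfl⟩ := J.quotMap_surjective x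
    obtain ⟨b, rfl⟩ := J.quotMap_surjective y
    exact congrArg J.quotMap (map_mul (S.α g) a b)
  map_add' x y := by
    obtain ⟨a, rfl⟩ := J.quotMap_surjective x
    obtain ⟨b, rfl⟩ := J.quotMap_surjective y
    exact congrArg J.quotMap (map_add (S.α g) a b)
  map_star' x := by
    obtain ⟨a, rfl⟩ := J.quotMap_surjective x
    exact congrArg J.quotMap (map_star (S.α g) a)
  map_smul' c x := by
    obtain ⟨a, rfl⟩ := J.quotMap_surjective x
    exact congrArg J.quotMap (map_smul (S.α g) c a)

theorem quotientAut_quotMap (hJ : S.IsInvariant J) (g : G) (a : A) :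
    S.quotientAut hJ g (J.quotMap a) = J.quotMap (S.α g a) := rfl

/-- The quotient system `Σ / J = (A / J, G, α̇, σ̇)`. -/
def quotient (hJ : S.IsInvariant J) : TwistedSystem J.Quot G where
  α := S.quotientAut hJ
  σ g h := ⟨J.quotMap (S.σ g h : A), by
    rw [Unitary.mem_iff, ← map_star, ← map_mul, ← map_mul]
    simp⟩
  α_comp g h x := by
    obtain ⟨a, rfl⟩ := J.quotMap_surjective x
    simp only [quotientAut_quotMap, ← map_star, ← map_mul, S.α_comp]
  cocycle g h k := by
    simp only [quotientAut_quotMap, ← map_mul, S.cocycle]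
  σ_one_right g := by ext; simp [S.σ_one_right]
  σ_one_left g := by ext; simp [S.σ_one_left]

end Quotient

/-! ### The canonical homomorphism onto the reduced crossed product of a quotient system -/

end TwistedSystem

section QuotientSpace

open scoped InnerProductSpace
open PositiveLinearMap UniformSpace

variable {A : Type u} [CStarAlgebra A] (J : ClosedIdeal A)

/-- The pull-back to `A` of a positive functional on `A / J`. -/
def pullFunctional (f : PosFunctional J.Quot) : PosFunctional A where
  toLinearMap := f.toLinearMap ∘ₗ J.quotMap.toAlgHom.toLinearMap
  monotone' _ _ h := f.monotone' (OrderHomClass.mono J.quotMap h)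

theorem pullFunctional_apply (f : PosFunctional J.Quot) (a : A) :
    pullFunctional J f a = f (J.quotMap a) := rfl

theorem pullFunctional_injective : Function.Injective (pullFunctional J) := fun f g h => by
  ext x
  obtain ⟨a, rfl⟩ := J.quotMap_surjective x
  rw [← pullFunctional_apply, h, pullFunctional_apply]

/-- The quotient map `A → A / J` as an isometry of pre-Hilbert spaces. -/
def preGNSQuot (f : PosFunctional J.Quot) : (pullFunctional J f).PreGNS →ₗᵢ[ℂ] f.PreGNS where
  toLinearMap := f.toPreGNS.toLinearMap ∘ₗ J.quotMap.toAlgHom.toLinearMap ∘ₗ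
    (pullFunctional J f).ofPreGNS.toLinearMap
  norm_map' x := by
    rw [preGNS_norm_def, preGNS_norm_def, pullFunctional_apply, map_mul J.quotMap, map_star J.quotMap]
    rfl

theorem preGNSQuot_surjective (f : PosFunctional J.Quot) :
    Function.Surjective (preGNSQuot J f) := fun y => by
  obtain ⟨a, ha⟩ := J.quotMap_surjective (f.ofPreGNS y)
  exact ⟨(pullFunctional J f).toPreGNS a, ha⟩

/-- The induced map of GNS spaces. -/
def gnsQuot (f : PosFunctional J.Quot) : (pullFunctional J f).GNS →L[ℂ] f.GNS :=
  (preGNSQuot J f).toContinuousLinearMap.completion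

theorem gnsQuot_norm (f : PosFunctional J.Quot) (ξ : (pullFunctional J f).GNS) :
    ‖gnsQuot J f ξ‖ = ‖ξ‖ := by
  induction ξ using Completion.induction_on with
  | hp => exact isClosed_eq (by fun_prop) (by fun_prop)
  | ih x =>
    rw [gnsQuot, ContinuousLinearMap.completion_apply_coe, Completion.norm_coe, Completion.norm_coe]
    exact (preGNSQuot J f).norm_map x

theorem gnsQuot_denseRange (f : PosFunctional J.Quot) : DenseRange (gnsQuot J f) := by
  refine Completion.denseRange_coe.mono ?_
  rintro _ ⟨y, rfl⟩
  obtain ⟨x, rfl⟩ := preGNSQuot_surjective J f y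
  exact ⟨x, ContinuousLinearMap.completion_apply_coe _ x⟩

theorem gnsQuot_intertwine (f : PosFunctional J.Quot) (a : A) (ξ : (pullFunctional J f).GNS) :
    gnsQuot J f ((pullFunctional J f).gnsStarAlgHom a ξ)
      = f.gnsStarAlgHom (J.quotMap a) (gnsQuot J f ξ) := by
  induction ξ using Completion.induction_on with
  | hp => exact isClosed_eq (by fun_prop) (by fun_prop)
  | ih x =>
    have h1 : (pullFunctional J f).gnsStarAlgHom a (x : (pullFunctional J f).GNS)
        = ((pullFunctional J f).leftMulMapPreGNS a x : (pullFunctional J f).GNS) :=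
      gnsNonUnitalStarAlgHom_apply_coe _
    have h2 : ∀ y : (pullFunctional J f).PreGNS, gnsQuot J f (y : (pullFunctional J f).GNS)
        = (preGNSQuot J f y : f.GNS) := fun y => ContinuousLinearMap.completion_apply_coe _ y
    have h3 : f.gnsStarAlgHom (J.quotMap a) (preGNSQuot J f x : f.GNS)
        = (f.leftMulMapPreGNS (J.quotMap a) (preGNSQuot J f x) : f.GNS) :=
      gnsNonUnitalStarAlgHom_apply_coe _
    rw [h1, h2, h2, h3]
    exact congrArg (fun y : f.PreGNS => (y : f.GNS)) (congrArg f.toPreGNS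
      (map_mul J.quotMap a ((pullFunctional J f).ofPreGNS x)))

theorem gnsQuot_comp_adjoint (f : PosFunctional J.Quot) (η : f.GNS) :
    gnsQuot J f (ContinuousLinearMap.adjoint (gnsQuot J f) η) = η := by
  have h1 : ∀ ξ, ContinuousLinearMap.adjoint (gnsQuot J f) (gnsQuot J f ξ) = ξ := fun ξ => by
    have := (ContinuousLinearMap.norm_map_iff_adjoint_comp_self (gnsQuot J f)).1 (gnsQuot_norm J f)
    exact DFunLike.congr_fun this ξ
  refine (gnsQuot_denseRange J f).induction_on η (isClosed_eq (by fun_prop) (by fun_prop))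
    fun ξ => ?_
  rw [h1]

/-- The canonical coisometry from the universal representation space of `A` to that of `A / J`:
restrict to the functionals that vanish on `J`. -/
def sumQuot : lp (fun f : PosFunctional A => f.GNS) 2 →L[ℂ]
    lp (fun f : PosFunctional J.Quot => f.GNS) 2 :=
  weightedComp (pullFunctional J) (pullFunctional_injective J) (gnsQuot J) 1 zero_le_one
    fun f => ContinuousLinearMap.opNorm_le_bound _ zero_le_one fun ξ => by
      rw [gnsQuot_norm, one_mul]

theorem sumQuot_comp_adjoint :
    sumQuot J ∘L ContinuousLinearMap.adjoint (sumQuot J) = ContinuousLinearMap.id ℂ _ := by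
  classical
  refine lp.ext_continuousLinearMap ENNReal.ofNat_ne_top fun f => ?_
  ext1 w
  have h : ContinuousLinearMap.adjoint (sumQuot J) (lp.single 2 f w)
      = lp.single 2 (pullFunctional J f) (ContinuousLinearMap.adjoint (gnsQuot J f) w) := by
    refine ext_inner_right ℂ fun ξ => ?_
    rw [ContinuousLinearMap.adjoint_inner_left, lp.inner_single_left, lp.inner_single_left,
      ContinuousLinearMap.adjoint_inner_left]
    rfl
  change sumQuot J (ContinuousLinearMap.adjoint (sumQuot J) (lp.single 2 f w)) = lp.single 2 f w
  rw [h]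
  ext g
  change gnsQuot J g ((lp.single 2 (pullFunctional J f)
    (ContinuousLinearMap.adjoint (gnsQuot J f) w) :
      lp (fun f : PosFunctional A => f.GNS) 2) (pullFunctional J g)) = _
  by_cases hg : g = f
  · subst hg
    rw [lp.single_apply_self, lp.single_apply_self, gnsQuot_comp_adjoint]
  · rw [lp.single_apply_ne _ _ _ hg,
      lp.single_apply_ne _ _ _ fun h => hg (pullFunctional_injective J h), map_zero]

/-- `sumQuot` as a map of the universal representation spaces. -/
def univQuot : UnivSpace A →L[ℂ] UnivSpace J.Quot := sumQuot J

theorem univQuot_comp_adjoint (η : UnivSpace J.Quot) :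
    univQuot J (ContinuousLinearMap.adjoint (univQuot J) η) = η :=
  DFunLike.congr_fun (sumQuot_comp_adjoint J) η

theorem univQuot_intertwine (a : A) (ξ : UnivSpace A) :
    univQuot J (univRep A a ξ) = univRep J.Quot (J.quotMap a) (univQuot J ξ) := by
  refine lp.ext (funext fun f => ?_)
  exact gnsQuot_intertwine J f a _

theorem univQuot_intertwine_adjoint (a : A) (η : UnivSpace J.Quot) :
    univRep A a (ContinuousLinearMap.adjoint (univQuot J) η)
      = ContinuousLinearMap.adjoint (univQuot J) (univRep J.Quot (J.quotMap a) η) := by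
  refine ext_inner_right ℂ fun ξ => ?_
  have h1 : univRep A a = ContinuousLinearMap.adjoint (univRep A (star a)) := by
    rw [← ContinuousLinearMap.star_eq_adjoint, ← map_star, star_star]
  have h2 : univRep J.Quot (J.quotMap a)
      = ContinuousLinearMap.adjoint (univRep J.Quot (J.quotMap (star a))) := by
    rw [← ContinuousLinearMap.star_eq_adjoint, ← map_star, ← map_star, star_star]
  rw [h1, h2, ContinuousLinearMap.adjoint_inner_left, ContinuousLinearMap.adjoint_inner_left,
    ContinuousLinearMap.adjoint_inner_left, ContinuousLinearMap.adjoint_inner_left,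
    univQuot_intertwine]

variable (G : Type v)

/-- The coisometry `ℓ²(G, H_A) → ℓ²(G, H_{A/J})`, coordinatewise `univQuot`. -/
def ellQuot : EllTwo G (UnivSpace A) →L[ℂ] EllTwo G (UnivSpace J.Quot) :=
  weightedComp id Function.injective_id (fun _ : G => univQuot J) ‖univQuot J‖ (norm_nonneg _)
    fun _ => le_rfl

/-- The adjoint of `ellQuot`. -/
def ellQuotAdj : EllTwo G (UnivSpace J.Quot) →L[ℂ] EllTwo G (UnivSpace A) :=
  weightedComp id Function.injective_id
    (fun _ : G => ContinuousLinearMap.adjoint (univQuot J)) ‖ContinuousLinearMap.adjoint (univQuot J)‖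
    (norm_nonneg _) fun _ => le_rfl

theorem ellQuotAdj_eq : ellQuotAdj J G = ContinuousLinearMap.adjoint (ellQuot J G) := by
  refine (ContinuousLinearMap.eq_adjoint_iff _ _).2 fun ξ η => ?_
  rw [lp.inner_eq_tsum, lp.inner_eq_tsum]
  exact tsum_congr fun h => ContinuousLinearMap.adjoint_inner_left _ _ _

theorem ellQuot_ellQuotAdj (η : EllTwo G (UnivSpace J.Quot)) :
    ellQuot J G (ellQuotAdj J G η) = η :=
  lp.ext (funext fun _ => univQuot_comp_adjoint J _)

end QuotientSpace

section Compress

variable {A : Type u} {G : Type v} [CStarAlgebra A] {J : ClosedIdeal A}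

/-- Compression of an operator on `ℓ²(G, H_A)` to `ℓ²(G, H_{A/J})`. -/
def compress (J : ClosedIdeal A) (x : EllTwo G (UnivSpace A) →L[ℂ] EllTwo G (UnivSpace A)) :
    EllTwo G (UnivSpace J.Quot) →L[ℂ] EllTwo G (UnivSpace J.Quot) :=
  ellQuot J G ∘L x ∘L ellQuotAdj J G

theorem continuous_compress (J : ClosedIdeal A) : Continuous (compress (G := G) J) :=
  (continuous_const.clm_comp (continuous_id.clm_comp continuous_const))

theorem compress_eq {x : EllTwo G (UnivSpace A) →L[ℂ] EllTwo G (UnivSpace A)}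
    {y : EllTwo G (UnivSpace J.Quot) →L[ℂ] EllTwo G (UnivSpace J.Quot)}
    (h : ellQuot J G ∘L x = y ∘L ellQuot J G) : compress J x = y := by
  ext1 η
  have := DFunLike.congr_fun h (ellQuotAdj J G η)
  simp only [ContinuousLinearMap.comp_apply, ellQuot_ellQuotAdj] at this
  exact this

theorem compress_mul {x y : EllTwo G (UnivSpace A) →L[ℂ] EllTwo G (UnivSpace A)}
    (hx : ellQuot J G ∘L x = compress J x ∘L ellQuot J G) :
    compress J (x * y) = compress J x * compress J y := by
  ext1 η
  exact DFunLike.congr_fun hx (y (ellQuotAdj J G η))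

theorem compress_star (x : EllTwo G (UnivSpace A) →L[ℂ] EllTwo G (UnivSpace A)) :
    compress J (star x) = star (compress J x) := by
  simp only [compress, ContinuousLinearMap.star_eq_adjoint, ContinuousLinearMap.adjoint_comp,
    ellQuotAdj_eq, ContinuousLinearMap.adjoint_adjoint]
  rfl

theorem compress_algebraMap (z : ℂ) :
    compress J (algebraMap ℂ (EllTwo G (UnivSpace A) →L[ℂ] EllTwo G (UnivSpace A)) z)
      = algebraMap ℂ _ z := by
  ext1 η
  simp only [compress, Algebra.algebraMap_eq_smul_one, ContinuousLinearMap.comp_apply,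
    smul_apply, one_apply_eq_self, map_smul, ellQuot_ellQuotAdj]

theorem compress_add (x y : EllTwo G (UnivSpace A) →L[ℂ] EllTwo G (UnivSpace A)) :
    compress J (x + y) = compress J x + compress J y := by
  ext1 η
  simp only [compress, ContinuousLinearMap.comp_apply, add_apply, map_add]

end Compress

namespace TwistedSystem

section CanonicalHom

variable {A : Type u} {G : Type v} [CStarAlgebra A] [Group G] (S : TwistedSystem A G)
  {J : ClosedIdeal A} (hJ : S.IsInvariant J)

/-- The operators that are intertwined with their compression, the latter being in the reduced
crossed product of the quotient system. -/
def Compatible (x : EllTwo G (UnivSpace A) →L[ℂ] EllTwo G (UnivSpace A)) : Prop :=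
  ellQuot J G ∘L x = compress J x ∘L ellQuot J G ∧
  x ∘L ellQuotAdj J G = ellQuotAdj J G ∘L compress J x ∧
  compress J x ∈ (S.quotient hJ).reducedCrossedProduct

theorem compatible_of_intertwine {x : EllTwo G (UnivSpace A) →L[ℂ] EllTwo G (UnivSpace A)}
    {y : EllTwo G (UnivSpace J.Quot) →L[ℂ] EllTwo G (UnivSpace J.Quot)}
    (h1 : ellQuot J G ∘L x = y ∘L ellQuot J G) (h2 : x ∘L ellQuotAdj J G = ellQuotAdj J G ∘L y)
    (hy : y ∈ (S.quotient hJ).reducedCrossedProduct) : S.Compatible hJ x := by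
  have h := compress_eq h1
  exact ⟨by rw [h]; exact h1, by rw [h]; exact h2, by rw [h]; exact hy⟩

theorem ellQuot_regA (a : A) :
    ellQuot J G ∘L S.regA a = (S.quotient hJ).regA (J.quotMap a) ∘L ellQuot J G := by
  ext1 ξ
  exact lp.ext (funext fun h => univQuot_intertwine J (S.α h⁻¹ a) (ξ h))

theorem ellQuotAdj_regA (a : A) :
    S.regA a ∘L ellQuotAdj J G = ellQuotAdj J G ∘L (S.quotient hJ).regA (J.quotMap a) := by
  ext1 ξ
  exact lp.ext (funext fun h => univQuot_intertwine_adjoint J (S.α h⁻¹ a) (ξ h))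

theorem ellQuot_regG (g : G) :
    ellQuot J G ∘L S.regG g = (S.quotient hJ).regG g ∘L ellQuot J G := by
  ext1 ξ
  exact lp.ext (funext fun h => univQuot_intertwine J (S.σ h⁻¹ g : A) (ξ (g⁻¹ * h)))

theorem ellQuotAdj_regG (g : G) :
    S.regG g ∘L ellQuotAdj J G = ellQuotAdj J G ∘L (S.quotient hJ).regG g := by
  ext1 ξ
  exact lp.ext (funext fun h => univQuot_intertwine_adjoint J (S.σ h⁻¹ g : A) (ξ (g⁻¹ * h)))

theorem compatible_of_mem {x : EllTwo G (UnivSpace A) →L[ℂ] EllTwo G (UnivSpace A)}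
    (hx : x ∈ S.reducedCrossedProduct) : S.Compatible hJ x := by
  have hcl : IsClosed {x | S.Compatible hJ x} := by
    have hc := continuous_compress (G := G) J
    refine (isClosed_eq (continuous_const.clm_comp continuous_id)
      (hc.clm_comp continuous_const)).inter ((isClosed_eq (continuous_id.clm_comp continuous_const)
      (continuous_const.clm_comp hc)).inter
      ((S.quotient hJ).isClosed_reducedCrossedProduct.preimage hc))
  refine closure_minimal (fun y hy => ?_) hcl hx
  induction hy using StarAlgebra.adjoin_induction with
  | mem y hy =>
    rcases hy with ⟨a, rfl⟩ | ⟨g, rfl⟩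
    · exact S.compatible_of_intertwine hJ (S.ellQuot_regA hJ a) (S.ellQuotAdj_regA hJ a)
        ((S.quotient hJ).inA (J.quotMap a)).2
    · exact S.compatible_of_intertwine hJ (S.ellQuot_regG hJ g) (S.ellQuotAdj_regG hJ g)
        ((S.quotient hJ).inG g).2
  | algebraMap z =>
    refine S.compatible_of_intertwine hJ (y := algebraMap ℂ _ z) ?_ ?_ (algebraMap_mem _ z)
    · ext1 ξ
      simp [Algebra.algebraMap_eq_smul_one]
    · ext1 ξ
      simp [Algebra.algebraMap_eq_smul_one]
  | add y z _ _ hy hz =>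
    refine S.compatible_of_intertwine hJ (y := compress J y + compress J z) ?_ ?_
      (add_mem hy.2.2 hz.2.2)
    · rw [ContinuousLinearMap.comp_add, ContinuousLinearMap.add_comp, hy.1, hz.1]
    · rw [ContinuousLinearMap.comp_add, ContinuousLinearMap.add_comp, hy.2.1, hz.2.1]
  | mul y z _ _ hy hz =>
    refine S.compatible_of_intertwine hJ (y := compress J y * compress J z) ?_ ?_
      (mul_mem hy.2.2 hz.2.2)
    · ext1 ξ
      have h1 := DFunLike.congr_fun hy.1 (z ξ)
      have h2 := DFunLike.congr_fun hz.1 ξ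
      simp only [ContinuousLinearMap.comp_apply, mul_apply_eq_comp] at h1 h2 ⊢
      rw [h1, h2]
    · ext1 ξ
      have h1 := DFunLike.congr_fun hy.2.1 (compress J z ξ)
      have h2 := DFunLike.congr_fun hz.2.1 ξ
      simp only [ContinuousLinearMap.comp_apply, mul_apply_eq_comp] at h1 h2 ⊢
      rw [h2, h1]
  | star y _ hy =>
    refine S.compatible_of_intertwine hJ (y := star (compress J y)) ?_ ?_ (star_mem hy.2.2)
    · have := congrArg ContinuousLinearMap.adjoint hy.2.1
      rwa [ContinuousLinearMap.adjoint_comp, ContinuousLinearMap.adjoint_comp, ellQuotAdj_eq,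
        ContinuousLinearMap.adjoint_adjoint] at this
    · have := congrArg ContinuousLinearMap.adjoint hy.1
      rwa [ContinuousLinearMap.adjoint_comp, ContinuousLinearMap.adjoint_comp, ← ellQuotAdj_eq]
        at this

/-- The canonical *-homomorphism `C*_r(Σ) → C*_r(Σ / J)`. -/
def canonicalHom : S.reducedCrossedProduct →⋆ₐ[ℂ] (S.quotient hJ).reducedCrossedProduct where
  toFun x := ⟨compress J x.1, (S.compatible_of_mem hJ x.2).2.2⟩
  map_one' := Subtype.ext (by simpa using compress_algebraMap (J := J) (G := G) 1)
  map_mul' x _ := Subtype.ext (compress_mul (S.compatible_of_mem hJ x.2).1)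
  map_zero' := Subtype.ext (by simpa using compress_algebraMap (J := J) (G := G) 0)
  map_add' x y := Subtype.ext (compress_add x.1 y.1)
  commutes' z := Subtype.ext (compress_algebraMap z)
  map_star' x := Subtype.ext (compress_star x.1)

theorem canonicalHom_inA (a : A) :
    S.canonicalHom hJ (S.inA a) = (S.quotient hJ).inA (J.quotMap a) :=
  Subtype.ext (compress_eq (S.ellQuot_regA hJ a))

theorem canonicalHom_inG (g : G) : S.canonicalHom hJ (S.inG g) = (S.quotient hJ).inG g :=
  Subtype.ext (compress_eq (S.ellQuot_regG hJ g))

end CanonicalHom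

section Exact

variable {A : Type u} {G : Type v} [CStarAlgebra A] [Group G] (S : TwistedSystem A G)

/-- The system is exact if, for every invariant ideal `J` of `A`, the kernel of the canonical
*-homomorphism `C*_r(Σ) → C*_r(Σ / J)` is the ideal `⟨J⟩` generated by `J`. -/
def IsExact : Prop :=
  ∀ (J : ClosedIdeal A) (hJ : S.IsInvariant J) (x : S.reducedCrossedProduct),
    S.canonicalHom hJ x = 0 ↔ x ∈ S.inducedIdeal J

/-- The action is trivial: every `α_g` is the identity. -/
def IsTrivialAction : Prop := ∀ g a, S.α g a = a

end Exact

end TwistedSystem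

end Universal

/-! ### The class of groups -/

section Groups

open scoped Pointwise

variable {G : Type v} [Group G]

/-- `T` is `M`-large: `m (G \ T) ⊆ T` for all `m ∈ M`. -/
def IsLarge (M T : Set G) : Prop := ∀ m ∈ M, ∀ t ∉ T, m * t ∈ T

/-- The set `{a g a⁻¹ | a ∈ M}`. -/
def conjBy (g : G) (M : Set G) : Set G := {x | ∃ a ∈ M, x = a * g * a⁻¹}

/-- `H` is a Powers set for `F`. -/
def IsPowersSet (H F : Set G) : Prop :=
  ∀ N : ℕ, ∃ (h : Fin N → G) (T : Fin N → Set G), (∀ j, h j ∈ H) ∧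
    (∀ i j, i ≠ j → Disjoint (T i) (T j)) ∧
    ∀ j, IsLarge {x | ∃ f ∈ F, x = h j * f * (h j)⁻¹} (T j)

/-- `H` is a c-Powers set for `g`. -/
def IsCPowersSet (H : Set G) (g : G) : Prop :=
  ∀ M : Set G, M.Finite → M.Nonempty → M ⊆ H → IsPowersSet H (conjBy g M)

variable (G)

/-- PH groups: every finite non-empty set of non-identity elements can be enumerated as
`f₁, …, fₙ` with a chain of subgroups `G₁ ≤ ⋯ ≤ Gₙ` such that `Gⱼ` is a c-Powers set for `fⱼ`. -/
def IsPHGroup : Prop :=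
  ∀ F : Finset G, F.Nonempty → 1 ∉ F →
    ∃ (n : ℕ) (f : Fin n → G) (K : Fin n → Subgroup G),
      Function.Injective f ∧ Set.range f = (F : Set G) ∧ Monotone K ∧
        ∀ j, IsCPowersSet (K j : Set G) (f j)

/-- Property `(P_com)`. -/
def HasPcom : Prop :=
  ∀ F : Finset G, F.Nonempty → 1 ∉ F →
    ∃ (n : ℕ) (g₀ : G) (U : Set G) (D : Fin n → Set G),
      Uᶜ ⊆ ⋃ k, D k ∧
      (∀ g ∈ F, (g • U) ∩ U = ∅) ∧
      ∀ j : ℕ, 1 ≤ j → ∀ k, ((g₀ ^ j)⁻¹ • D k) ∩ D k = ∅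

/-- The class `𝒫`: PH groups and groups with property `(P_com)`. -/
def InClassP : Prop := IsPHGroup G ∨ HasPcom G

end Groups

end

/-!
The proof is by Powers averaging. Let `E` be the conditional expectation of the reduced crossed
product onto `A`, realized here as the compression `corner` to the coordinate `e` of `ℓ²(G, H)`.

Since `α` is trivial, `σ` takes central values and `λ(g)` commutes with `A`, so a mean of the inner
automorphisms `x ↦ λ(g) x λ(g)*` fixes `A`. It also leaves closed ideals invariant and is
contractive. For a group in the class `𝒫`, suitable means make any finite sum
`∑ π(a_g) λ(g)` without term at `e` arbitrarily small (`exists_isAveraging_norm_le`). Both kinds of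
groups are treated by one estimate, `norm_average_le`: if the sets `T_j` overlap at most `n` times
and are large for the conjugates `h_j F h_j⁻¹` of the support `F` of `x`, then the mean of `x` over
`h_1, …, h_N` has norm at most `2 √(n / N) ‖x‖`. For a PH group `n = 1`, and the terms of the sum are
treated one after the other along the chain of subgroups; for a group with property `(P_com)`, the
elements `g₀ʲ` and the sets `g₀ʲ (G \ U)` deal with all terms at once.

Approximating `x` in a closed ideal `I` by finite sums and averaging shows `E(x) ∈ I`
(`exists_inAHom_mem`). As `λ(l⁻¹) x λ(k) ∈ I` as well, all matrix coefficients of the image of `x` in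
the reduced crossed product of `Σ / J`, where `J = I ∩ A`, vanish, so by exactness `x ∈ ⟨J⟩`. This
gives surjectivity. Injectivity is `⟨J⟩ ∩ A = J`, which by exactness reduces to the faithfulness of
the universal representation of `A / J`, the Gelfand-Naimark theorem (`univRep_injective`), proved
here by separating a point from the cone of positive elements.
-/

/-! ### Faithfulness of the universal representation -/

section GelfandNaimark

attribute [local instance 50] CStarAlgebra.spectralOrder CStarAlgebra.spectralOrderedRing

open scoped ComplexOrder

theorem add_star_div_two (z : ℂ) : (z + star z) / 2 = (z.re : ℂ) := by
  rw [Complex.star_def, Complex.add_conj]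
  push_cast
  ring

/-- The hermitian part `a ↦ (g(a) + conj g(a*)) / 2` of a functional whose real part is nonnegative
on positive elements, as a positive functional. -/
noncomputable def hermitianPart {A : Type u} [CStarAlgebra A] (g : StrongDual ℂ A)
    (hg : ∀ a : A, 0 ≤ a → 0 ≤ (g a).re) : PosFunctional A :=
  PositiveLinearMap.mk₀
    { toFun := fun a => (g a + star (g (star a))) / 2
      map_add' := fun a b => by simp only [star_add, map_add]; ring
      map_smul' := fun c a => by
        simp only [star_smul, map_smul, smul_eq_mul, star_mul', star_star, RingHom.id_apply]
        ring }
    fun a ha => by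
      change (0 : ℂ) ≤ (g a + star (g (star a))) / 2
      rw [ha.star_eq, add_star_div_two]
      exact_mod_cast hg a ha

theorem hermitianPart_apply_of_nonneg {A : Type u} [CStarAlgebra A] (g : StrongDual ℂ A)
    (hg : ∀ a : A, 0 ≤ a → 0 ≤ (g a).re) {a : A} (ha : 0 ≤ a) :
    hermitianPart g hg a = (g a).re := by
  change (g a + star (g (star a))) / 2 = _
  rw [ha.star_eq, add_star_div_two]

/-- Positive functionals detect nonzero positive elements: `-b` can be separated from the closed
convex cone of positive elements. -/
theorem exists_posFunctional_ne_zero {A : Type u} [CStarAlgebra A] {b : A} (hb : 0 ≤ b)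
    (hb0 : b ≠ 0) : ∃ f : PosFunctional A, f b ≠ 0 := by
  have hconv : Convex ℝ {a : A | 0 ≤ a} := fun x (hx : 0 ≤ x) y (hy : 0 ≤ y) s t hs ht _ =>
    show 0 ≤ s • x + t • y from add_nonneg (smul_nonneg hs hx) (smul_nonneg ht hy)
  have hnot : -b ∉ {a : A | 0 ≤ a} := fun h => hb0 (le_antisymm (neg_nonneg.1 h) hb)
  obtain ⟨g, r, hr, hpos⟩ := RCLike.geometric_hahn_banach_point_closed (𝕜 := ℂ) hconv
    (CStarAlgebra.isClosed_nonneg (A := A)) hnot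
  have hr0 : r < 0 := by simpa using hpos 0 (le_refl (0 : A))
  have hg : ∀ a : A, 0 ≤ a → 0 ≤ (g a).re := fun a ha => by
    by_contra! hlt
    -- a large multiple of `a` would violate the lower bound `r` on the cone
    have h := hpos ((r / (g a).re) • a) (smul_nonneg (div_nonneg_of_nonpos hr0.le hlt.le) ha)
    rw [show ((r / (g a).re) • a : A) = ((r / (g a).re : ℝ) : ℂ) • a from
      (Complex.coe_smul _ _).symm, map_smul, smul_eq_mul] at h
    simp only [RCLike.re_to_complex, Complex.re_ofReal_mul] at h
    rw [div_mul_cancel₀ _ hlt.ne] at h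
    exact lt_irrefl _ h
  refine ⟨hermitianPart g hg, ?_⟩
  rw [hermitianPart_apply_of_nonneg g hg hb]
  have : (g (-b)).re < r := hr
  rw [map_neg, Complex.neg_re] at this
  exact_mod_cast (by linarith : (0 : ℝ) < (g b).re).ne'

/-- The Gelfand-Naimark theorem: the cyclic vector of the GNS space of a functional `f` with
`f(a* a) ≠ 0` is not killed by `a`. -/
theorem univRep_injective (A : Type u) [CStarAlgebra A] : Function.Injective (univRep A) := by
  classical
  refine (injective_iff_map_eq_zero _).2 fun a ha => ?_
  by_contra hne
  obtain ⟨f, hf⟩ := exists_posFunctional_ne_zero (star_mul_self_nonneg a)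
    (by simpa using hne : star a * a ≠ 0)
  refine hf ?_
  have h1 : f.gnsStarAlgHom a (f.toPreGNS 1 : f.GNS) = 0 := by
    have h := DFunLike.congr_fun ha
      (lp.single 2 f (f.toPreGNS 1 : f.GNS) : lp (fun f : PosFunctional A => f.GNS) 2)
    have h' : f.gnsStarAlgHom a ((lp.single 2 f (f.toPreGNS 1 : f.GNS) :
        lp (fun f : PosFunctional A => f.GNS) 2) f) = 0 := congrArg
      (fun ξ : lp (fun f : PosFunctional A => f.GNS) 2 => ξ f) h
    rwa [lp.single_apply_self] at h'
  have h2 : f.gnsStarAlgHom a (f.toPreGNS 1 : f.GNS)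
      = (f.leftMulMapPreGNS a (f.toPreGNS 1) : f.GNS) :=
    PositiveLinearMap.gnsNonUnitalStarAlgHom_apply_coe _
  rw [h1] at h2
  have h3 : ‖f.leftMulMapPreGNS a (f.toPreGNS 1)‖ = 0 := by
    rw [← UniformSpace.Completion.norm_coe, ← h2, norm_zero]
  have h4 := f.preGNS_norm_sq (f.leftMulMapPreGNS a (f.toPreGNS 1))
  rw [h3] at h4
  have h5 : f.ofPreGNS (f.leftMulMapPreGNS a (f.toPreGNS 1)) = a := mul_one a
  rw [h5] at h4
  simpa using h4.symm

theorem univRep_isometry (A : Type u) [CStarAlgebra A] : Isometry (univRep A) :=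
  NonUnitalStarAlgHom.isometry (univRep A) (univRep_injective A)

theorem isClosed_range_univRep (A : Type u) [CStarAlgebra A] :
    IsClosed (Set.range (univRep A)) :=
  (univRep_isometry A).isClosedEmbedding.isClosed_range

end GelfandNaimark

/-! ### Sums of operators on `ℓ²(G, K)` that are almost orthogonal -/

section AlmostOrthogonal

theorem norm_weightedComp_le {ι κ : Type*} {H : κ → Type*} {K : ι → Type*}
    [∀ k, NormedAddCommGroup (H k)] [∀ k, InnerProductSpace ℂ (H k)]
    [∀ i, NormedAddCommGroup (K i)] [∀ i, InnerProductSpace ℂ (K i)]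
    (e : ι → κ) (he : Function.Injective e) (c : ∀ i, H (e i) →L[ℂ] K i)
    (C : ℝ) (hC : 0 ≤ C) (hc : ∀ i, ‖c i‖ ≤ C) : ‖weightedComp e he c C hC hc‖ ≤ C := by
  unfold weightedComp
  exact LinearMap.mkContinuous_norm_le _ hC _

variable {G : Type v} {K : Type u} [NormedAddCommGroup K] [InnerProductSpace ℂ K]

theorem EllTwo.summable_norm_sq (ξ : EllTwo G K) : Summable fun t => ‖ξ t‖ ^ 2 := by
  simpa using (lp.memℓp ξ).summable (p := 2) (by norm_num)

theorem EllTwo.norm_sq_eq (ξ : EllTwo G K) : ‖ξ‖ ^ 2 = ∑' t, ‖ξ t‖ ^ 2 := by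
  simpa using lp.norm_rpow_eq_tsum (p := 2) (by norm_num) ξ

/-- The projection of `ℓ²(G, K)` onto `ℓ²(T, K)`. -/
noncomputable def coordProj (T : Set G) : EllTwo G K →L[ℂ] EllTwo G K :=
  weightedComp id Function.injective_id
    (T.indicator fun _ => ContinuousLinearMap.id ℂ K) 1 zero_le_one fun t => by
      refine (norm_indicator_le_norm_self _ _).trans ContinuousLinearMap.norm_id_le

theorem coordProj_apply_of_mem {T : Set G} {t : G} (ht : t ∈ T) (ξ : EllTwo G K) :
    coordProj T ξ t = ξ t := by
  simp [coordProj, ht]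

theorem coordProj_apply_of_notMem {T : Set G} {t : G} (ht : t ∉ T) (ξ : EllTwo G K) :
    coordProj T ξ t = 0 := by
  simp [coordProj, ht]

theorem norm_coordProj_apply_le (T : Set G) (ξ : EllTwo G K) : ‖coordProj T ξ‖ ≤ ‖ξ‖ := by
  exact (ContinuousLinearMap.le_of_opNorm_le _ (norm_weightedComp_le ..) ξ).trans_eq (one_mul _)

open Classical in
/-- If every point lies in at most `n` of the sets `T j`, then the ranges of the projections
onto `ℓ²(T j)` are orthogonal up to a factor `n`. -/
theorem norm_sum_coordProj_sq_le {N n : ℕ} {T : Fin N → Set G}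
    (hT : ∀ t, (Finset.univ.filter fun j => t ∈ T j).card ≤ n) (η : Fin N → EllTwo G K) :
    ‖∑ j, coordProj (T j) (η j)‖ ^ 2 ≤ n * ∑ j, ‖η j‖ ^ 2 := by
  simp only [EllTwo.norm_sq_eq]
  rw [← Summable.tsum_finsetSum fun j _ => EllTwo.summable_norm_sq (η j), ← tsum_mul_left]
  refine (EllTwo.summable_norm_sq _).tsum_le_tsum (fun t => ?_)
    ((summable_sum fun j _ => EllTwo.summable_norm_sq (η j)).mul_left _)
  have h1 : (∑ j, coordProj (T j) (η j) : EllTwo G K) t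
      = ∑ j ∈ Finset.univ.filter (fun j => t ∈ T j), η j t := by
    rw [lp.coeFn_sum, Finset.sum_apply, Finset.sum_filter]
    refine Finset.sum_congr rfl fun j _ => ?_
    split_ifs with h
    · exact coordProj_apply_of_mem h _
    · exact coordProj_apply_of_notMem h _
  rw [h1]
  calc _ ≤ (∑ j ∈ Finset.univ.filter (fun j => t ∈ T j), ‖η j t‖) ^ 2 := by
        gcongr
        exact norm_sum_le _ _
    _ ≤ (Finset.univ.filter fun j => t ∈ T j).card
          * ∑ j ∈ Finset.univ.filter (fun j => t ∈ T j), ‖η j t‖ ^ 2 := sq_sum_le_card_mul_sum_sq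
    _ ≤ n * ∑ j, ‖η j t‖ ^ 2 := by
        gcongr
        · exact hT t
        · exact Finset.subset_univ _

open Classical in
theorem sum_norm_coordProj_sq_le {N n : ℕ} {T : Fin N → Set G}
    (hT : ∀ t, (Finset.univ.filter fun j => t ∈ T j).card ≤ n) (ξ : EllTwo G K) :
    ∑ j, ‖coordProj (T j) ξ‖ ^ 2 ≤ n * ‖ξ‖ ^ 2 := by
  simp only [EllTwo.norm_sq_eq]
  rw [← Summable.tsum_finsetSum fun j _ => EllTwo.summable_norm_sq _, ← tsum_mul_left]
  refine (summable_sum fun j _ => EllTwo.summable_norm_sq _).tsum_le_tsum (fun t => ?_)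
    ((EllTwo.summable_norm_sq ξ).mul_left _)
  have h1 : ∑ j, ‖coordProj (T j) ξ t‖ ^ 2
      = ∑ j ∈ Finset.univ.filter (fun j => t ∈ T j), ‖ξ t‖ ^ 2 := by
    rw [Finset.sum_filter]
    refine Finset.sum_congr rfl fun j _ => ?_
    split_ifs with h
    · rw [coordProj_apply_of_mem h]
    · rw [coordProj_apply_of_notMem h, norm_zero, zero_pow two_ne_zero]
  rw [h1, Finset.sum_const, nsmul_eq_mul]
  gcongr
  exact hT t

open Classical in
/-- If `y j` has no component from `ℓ²(G \ T j)` to itself, where every point lies in at most `n` of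
the `N` sets `T j`, then the norm of `∑ y j` grows at most like `√N`. -/
theorem norm_sum_apply_le_of_large {N n : ℕ} {T : Fin N → Set G}
    (hT : ∀ t, (Finset.univ.filter fun j => t ∈ T j).card ≤ n)
    {y : Fin N → EllTwo G K →L[ℂ] EllTwo G K} {C : ℝ} (hC : 0 ≤ C) (hyC : ∀ j, ‖y j‖ ≤ C)
    (hy : ∀ j ξ, (∀ t ∈ T j, ξ t = 0) → ∀ t ∉ T j, y j ξ t = 0) :
    ‖∑ j, y j‖ ≤ 2 * (√(n * N) * C) := by
  refine ContinuousLinearMap.opNorm_le_bound _ (by positivity) fun ξ => ?_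
  -- `y j = P y j + (1 - P) y j P` for the projection `P` onto `ℓ²(T j)`
  have hdec : ∀ j, y j ξ
      = coordProj (T j) (y j ξ) + coordProj (T j)ᶜ (y j (coordProj (T j) ξ)) := fun j => by
    ext t
    rw [lp.coeFn_add, Pi.add_apply]
    by_cases ht : t ∈ T j
    · rw [coordProj_apply_of_mem ht, coordProj_apply_of_notMem (by simpa using ht), add_zero]
    · rw [coordProj_apply_of_notMem ht, coordProj_apply_of_mem (by simpa using ht), zero_add]
      have h := hy j (ξ - coordProj (T j) ξ)
        (fun s hs => by rw [lp.coeFn_sub, Pi.sub_apply, coordProj_apply_of_mem hs, sub_self]) t ht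
      rwa [map_sub, lp.coeFn_sub, Pi.sub_apply, sub_eq_zero] at h
  have hsq : √((n : ℝ) * N) ^ 2 = n * N := Real.sq_sqrt (by positivity)
  have h1 : ‖∑ j, coordProj (T j) (y j ξ)‖ ≤ √(n * N) * C * ‖ξ‖ := by
    refine le_of_sq_le_sq ?_ (by positivity)
    refine (norm_sum_coordProj_sq_le hT _).trans ?_
    calc (n : ℝ) * ∑ j, ‖y j ξ‖ ^ 2 ≤ n * ∑ _j : Fin N, (C * ‖ξ‖) ^ 2 := by
          gcongr with j
          exact (y j).le_of_opNorm_le (hyC j) ξ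
      _ = _ := by
          rw [Finset.sum_const, Finset.card_univ, Fintype.card_fin, nsmul_eq_mul, mul_pow, mul_pow,
            mul_pow, hsq]
          ring
  have h2 : ‖∑ j, coordProj (T j)ᶜ (y j (coordProj (T j) ξ))‖ ≤ √(n * N) * C * ‖ξ‖ := by
    refine le_of_sq_le_sq ?_ (by positivity)
    calc _ ≤ (∑ j, C * ‖coordProj (T j) ξ‖) ^ 2 := by
          gcongr
          refine (norm_sum_le _ _).trans (Finset.sum_le_sum fun j _ => ?_)
          exact (norm_coordProj_apply_le _ _).trans ((y j).le_of_opNorm_le (hyC j) _)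
      _ = C ^ 2 * (∑ j, ‖coordProj (T j) ξ‖) ^ 2 := by rw [← Finset.mul_sum, mul_pow]
      _ ≤ C ^ 2 * (N * ∑ j, ‖coordProj (T j) ξ‖ ^ 2) := by
          gcongr
          simpa using sq_sum_le_card_mul_sum_sq (s := (Finset.univ : Finset (Fin N)))
            (f := fun j => ‖coordProj (T j) ξ‖)
      _ ≤ C ^ 2 * (N * (n * ‖ξ‖ ^ 2)) := by
          gcongr
          exact sum_norm_coordProj_sq_le hT ξ
      _ = _ := by
          rw [mul_pow, mul_pow, hsq]
          ring
  rw [sum_apply, Finset.sum_congr rfl fun j _ => hdec j, Finset.sum_add_distrib]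
  refine (norm_add_le _ _).trans ((add_le_add h1 h2).trans_eq ?_)
  ring

end AlmostOrthogonal

/-! ### The regular covariant representation of a trivial action -/

namespace TwistedSystem

variable {A : Type u} {G : Type v} [CStarAlgebra A] [Group G] (S : TwistedSystem A G)

/-- The representation `π` of `A` on `ℓ²(G, H)`, as a *-homomorphism. -/
noncomputable def regAHom :
    A →⋆ₐ[ℂ] (EllTwo G (UnivSpace A) →L[ℂ] EllTwo G (UnivSpace A)) where
  toFun := S.regA
  map_one' := by ext1 ξ; ext h; simp
  map_mul' a b := by ext1 ξ; ext h; simp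
  map_zero' := by ext1 ξ; ext h; simp
  map_add' a b := by ext1 ξ; ext h; simp
  commutes' z := by
    ext1 ξ
    ext h
    rw [regA_apply, AlgHomClass.commutes, AlgHomClass.commutes]
    simp [Algebra.algebraMap_eq_smul_one]
  map_star' a := by
    refine (ContinuousLinearMap.eq_adjoint_iff _ _).2 fun ξ η => ?_
    rw [lp.inner_eq_tsum, lp.inner_eq_tsum]
    refine tsum_congr fun h => ?_
    rw [regA_apply, regA_apply, map_star, map_star, ContinuousLinearMap.star_eq_adjoint,
      ContinuousLinearMap.adjoint_inner_left]

/-- The embedding of `A` in the reduced crossed product, as a *-homomorphism. -/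
noncomputable def inAHom : A →⋆ₐ[ℂ] S.reducedCrossedProduct :=
  S.regAHom.codRestrict S.reducedCrossedProduct fun a => (S.inA a).2

theorem inAHom_apply (a : A) : S.inAHom a = S.inA a := rfl

theorem inG_one : S.inG 1 = 1 := by
  refine Subtype.ext ?_
  change S.regG 1 = 1
  ext1 ξ
  ext h
  simp [S.σ_one_right]

/-- The cocycle identity says that `λ` is a projective representation with multiplier `σ`. -/
theorem inG_mul (g k : G) : S.inG g * S.inG k = S.inAHom (S.σ g k) * S.inG (g * k) := by
  refine Subtype.ext ?_
  change S.regG g * S.regG k = S.regA (S.σ g k) * S.regG (g * k)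
  ext1 ξ
  ext h
  have hc := S.cocycle h⁻¹ g k
  simp only [mul_apply_eq_comp, regG_apply, regA_apply]
  rw [← mul_apply_eq_comp, ← mul_apply_eq_comp, ← map_mul, ← map_mul, ← hc]
  simp [mul_assoc]

theorem norm_inG_le (g : G) : ‖S.inG g‖ ≤ 1 := by
  change ‖S.regG g‖ ≤ 1
  unfold regG
  exact norm_weightedComp_le ..

theorem inG_mul_inv (g : G) :
    S.inG g * (S.inG g⁻¹ * S.inAHom (star (S.σ g g⁻¹ : A))) = 1 := by
  rw [← mul_assoc, inG_mul, mul_inv_cancel, inG_one, mul_one, ← map_mul,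
    Unitary.mul_star_self_of_mem (S.σ g g⁻¹).2, map_one]

variable {S}

/-- If `α` is trivial, then `α_g ∘ α_h = Ad(σ(g, h)) ∘ α_{gh}` says that `σ` is central. -/
theorem IsTrivialAction.commute_σ (hS : S.IsTrivialAction) (g h : G) (a : A) :
    Commute (S.σ g h : A) a := by
  have h1 := S.α_comp g h a
  rw [hS, hS, hS] at h1
  change (S.σ g h : A) * a = a * S.σ g h
  nth_rw 2 [h1]
  rw [mul_assoc, Unitary.coe_star_mul_self, mul_one]

theorem IsTrivialAction.commute_inG (hS : S.IsTrivialAction) (g : G) (a : A) :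
    Commute (S.inG g) (S.inAHom a) := by
  refine Subtype.ext ?_
  change S.regG g * S.regA a = S.regA a * S.regG g
  ext1 ξ
  ext h
  simp only [mul_apply_eq_comp, regG_apply, regA_apply, hS _ a]
  rw [← mul_apply_eq_comp, ← mul_apply_eq_comp, ← map_mul, ← map_mul, (hS.commute_σ _ _ a).eq]

theorem IsTrivialAction.σ_inv_comm (hS : S.IsTrivialAction) (g : G) :
    (S.σ g⁻¹ g : A) = S.σ g g⁻¹ := by
  have h := S.cocycle g g⁻¹ g
  rw [hS] at h
  simpa [S.σ_one_left, S.σ_one_right] using h.symm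

theorem IsTrivialAction.inv_mul_inG (hS : S.IsTrivialAction) (g : G) :
    S.inG g⁻¹ * S.inAHom (star (S.σ g g⁻¹ : A)) * S.inG g = 1 := by
  rw [(hS.commute_inG _ _).eq, mul_assoc, inG_mul, inv_mul_cancel, inG_one, mul_one, ← map_mul,
    hS.σ_inv_comm, Unitary.coe_star_mul_self, map_one]

/-- The elements `λ(g)` are unitary, as invertible contractions with contractive inverse. -/
theorem IsTrivialAction.inG_star_mul_self (hS : S.IsTrivialAction) (g : G) :
    star (S.inG g) * S.inG g = 1 := by
  refine Subtype.ext ?_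
  change ContinuousLinearMap.adjoint (S.regG g) ∘L S.regG g = 1
  refine (ContinuousLinearMap.norm_map_iff_adjoint_comp_self _).1 fun ξ => le_antisymm ?_ ?_
  · exact ((S.regG g).le_of_opNorm_le (S.norm_inG_le g) ξ).trans_eq (one_mul _)
  · have hW : ‖(S.inG g⁻¹ * S.inAHom (star (S.σ g g⁻¹ : A))).1‖ ≤ 1 := by
      refine (norm_mul_le (S.inG g⁻¹) (S.inAHom (star (S.σ g g⁻¹ : A)))).trans ?_
      refine mul_le_one₀ (S.norm_inG_le _) (norm_nonneg _) ?_
      refine (NonUnitalStarAlgHom.norm_apply_le S.inAHom _).trans ?_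
      rw [norm_star]
      exact norm_unitary_le_one _
    have h1 := DFunLike.congr_fun (congrArg Subtype.val (hS.inv_mul_inG g)) ξ
    have h2 := (ContinuousLinearMap.le_of_opNorm_le _ hW (S.regG g ξ)).trans_eq (one_mul _)
    calc ‖ξ‖ = _ := (congrArg norm h1).symm
      _ ≤ _ := h2

theorem IsTrivialAction.star_inG (hS : S.IsTrivialAction) (g : G) :
    star (S.inG g) = S.inG g⁻¹ * S.inAHom (star (S.σ g g⁻¹ : A)) :=
  left_inv_eq_right_inv (hS.inG_star_mul_self g) (S.inG_mul_inv g)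

theorem IsTrivialAction.inG_mul_star_self (hS : S.IsTrivialAction) (g : G) :
    S.inG g * star (S.inG g) = 1 := by
  rw [hS.star_inG, S.inG_mul_inv]

/-! ### Finite sums -/

variable (S) in
/-- The finite sum `∑ π(a_g) λ(g)`. -/
noncomputable def finiteSum (a : G →₀ A) : S.reducedCrossedProduct :=
  a.sum fun g b => S.inAHom b * S.inG g

variable (S) in
theorem finiteSum_single (g : G) (b : A) :
    S.finiteSum (Finsupp.single g b) = S.inAHom b * S.inG g := by
  simp [finiteSum]

variable (S) in
theorem finiteSum_add (a b : G →₀ A) : S.finiteSum (a + b) = S.finiteSum a + S.finiteSum b :=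
  Finsupp.sum_add_index' (by simp) (by simp [add_mul])

theorem IsTrivialAction.exists_finiteSum_mul (hS : S.IsTrivialAction) (a b : G →₀ A) :
    ∃ c, S.finiteSum c = S.finiteSum a * S.finiteSum b := by
  induction a using Finsupp.induction_linear with
  | zero => exact ⟨0, by simp [finiteSum]⟩
  | add a a' h h' =>
    obtain ⟨c, hc⟩ := h
    obtain ⟨c', hc'⟩ := h'
    exact ⟨c + c', by rw [finiteSum_add, finiteSum_add, hc, hc', add_mul]⟩
  | single g x =>
    induction b using Finsupp.induction_linear with
    | zero => exact ⟨0, by simp [finiteSum]⟩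
    | add b b' h h' =>
      obtain ⟨c, hc⟩ := h
      obtain ⟨c', hc'⟩ := h'
      exact ⟨c + c', by rw [finiteSum_add, finiteSum_add, hc, hc', mul_add]⟩
    | single k y =>
      refine ⟨Finsupp.single (g * k) (x * y * S.σ g k), ?_⟩
      simp only [finiteSum_single]
      rw [map_mul, map_mul, mul_assoc, ← inG_mul, mul_assoc, mul_assoc, ← mul_assoc (S.inG g),
        (hS.commute_inG g y).eq, mul_assoc]

theorem IsTrivialAction.exists_finiteSum_star (hS : S.IsTrivialAction) (a : G →₀ A) :
    ∃ c, S.finiteSum c = star (S.finiteSum a) := by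
  induction a using Finsupp.induction_linear with
  | zero => exact ⟨0, by simp [finiteSum]⟩
  | add a a' h h' =>
    obtain ⟨c, hc⟩ := h
    obtain ⟨c', hc'⟩ := h'
    exact ⟨c + c', by rw [finiteSum_add, finiteSum_add, hc, hc', star_add]⟩
  | single g x =>
    refine ⟨Finsupp.single g⁻¹ (star (S.σ g g⁻¹ : A) * star x), ?_⟩
    rw [finiteSum_single, finiteSum_single, star_mul, hS.star_inG, ← map_star, mul_assoc, ← map_mul,
      (hS.commute_inG _ _).eq]

/-- Finite sums are dense: they form a *-subalgebra containing the generators. -/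
theorem IsTrivialAction.exists_finiteSum_norm_sub_lt (hS : S.IsTrivialAction)
    (x : S.reducedCrossedProduct) {ε : ℝ} (hε : 0 < ε) :
    ∃ a : G →₀ A, ‖x - S.finiteSum a‖ < ε := by
  obtain ⟨y, hy, hxy⟩ := Metric.mem_closure_iff.1 x.2 ε hε
  suffices h : ∃ a, (S.finiteSum a : EllTwo G (UnivSpace A) →L[ℂ] EllTwo G (UnivSpace A)) = y by
    obtain ⟨a, rfl⟩ := h
    exact ⟨a, (dist_eq_norm _ _).symm.trans_lt hxy⟩
  clear hxy
  induction hy using StarAlgebra.adjoin_induction with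
  | mem y hy =>
    rcases hy with ⟨a, rfl⟩ | ⟨g, rfl⟩
    · exact ⟨Finsupp.single 1 a, by rw [finiteSum_single, inG_one, mul_one]; rfl⟩
    · exact ⟨Finsupp.single g 1, by rw [finiteSum_single, map_one, one_mul]; rfl⟩
  | algebraMap z =>
    exact ⟨Finsupp.single 1 (algebraMap ℂ A z), by
      rw [finiteSum_single, inG_one, mul_one, AlgHomClass.commutes]; rfl⟩
  | add y z _ _ hy hz =>
    obtain ⟨a, rfl⟩ := hy
    obtain ⟨b, rfl⟩ := hz
    exact ⟨a + b, by rw [finiteSum_add]; rfl⟩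
  | mul y z _ _ hy hz =>
    obtain ⟨a, rfl⟩ := hy
    obtain ⟨b, rfl⟩ := hz
    obtain ⟨c, hc⟩ := hS.exists_finiteSum_mul a b
    exact ⟨c, by rw [hc]; rfl⟩
  | star y _ hy =>
    obtain ⟨a, rfl⟩ := hy
    obtain ⟨c, hc⟩ := hS.exists_finiteSum_star a
    exact ⟨c, by rw [hc]; rfl⟩

end TwistedSystem

/-! ### Supports of operators on `ℓ²(G, K)` -/

section Support

variable {G : Type v} [Group G] {K : Type u} [NormedAddCommGroup K] [InnerProductSpace ℂ K]

/-- The operator `x` is supported on `F ⊆ G`: the value of `x ξ` at `t` depends only on the values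
of `ξ` on `F⁻¹ t`. -/
def IsSupportedOn (F : Set G) (x : EllTwo G K →L[ℂ] EllTwo G K) : Prop :=
  ∀ ξ t, (∀ f ∈ F, ξ (f⁻¹ * t) = 0) → x ξ t = 0

namespace IsSupportedOn

variable {F F' : Set G} {x y : EllTwo G K →L[ℂ] EllTwo G K}

theorem mono (hx : IsSupportedOn F x) (h : F ⊆ F') : IsSupportedOn F' x :=
  fun ξ t ht => hx ξ t fun f hf => ht f (h hf)

open Pointwise in
theorem mul (hx : IsSupportedOn F x) (hy : IsSupportedOn F' y) :
    IsSupportedOn (F * F') (x * y) := fun ξ t ht => by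
  refine hx (y ξ) t fun f hf => hy ξ _ fun f' hf' => ?_
  rw [← mul_assoc, ← mul_inv_rev]
  exact ht _ (Set.mul_mem_mul hf hf')

theorem smul (hx : IsSupportedOn F x) (c : ℂ) : IsSupportedOn F (c • x) := fun ξ t ht => by
  simp [hx ξ t ht]

theorem sum {ι : Type*} {s : Finset ι} {x : ι → EllTwo G K →L[ℂ] EllTwo G K}
    (hx : ∀ i ∈ s, IsSupportedOn F (x i)) : IsSupportedOn F (∑ i ∈ s, x i) := fun ξ t ht => by
  rw [sum_apply, lp.coeFn_sum, Finset.sum_apply]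
  exact Finset.sum_eq_zero fun i hi => hx i hi ξ t ht

end IsSupportedOn

end Support

namespace TwistedSystem

variable {A : Type u} {G : Type v} [CStarAlgebra A] [Group G] {S : TwistedSystem A G}

variable (S) in
theorem isSupportedOn_inAHom (a : A) : IsSupportedOn {1} (S.inAHom a).1 := fun ξ t ht => by
  have h : ξ t = 0 := by simpa using ht
  change S.regA a ξ t = 0
  rw [regA_apply, h, map_zero]

variable (S) in
theorem isSupportedOn_inG (g : G) : IsSupportedOn {g} (S.inG g).1 := fun ξ t ht => by
  change S.regG g ξ t = 0
  rw [regG_apply, ht g rfl, map_zero]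

theorem IsTrivialAction.isSupportedOn_star_inG (hS : S.IsTrivialAction) (g : G) :
    IsSupportedOn {g⁻¹} (star (S.inG g)).1 := by
  rw [hS.star_inG]
  refine ((S.isSupportedOn_inG g⁻¹).mul (S.isSupportedOn_inAHom _)).mono ?_
  simp

variable (S) in
/-- The inner automorphism `x ↦ λ(g) x λ(g)*` of the reduced crossed product, as a linear map. -/
noncomputable def conjG (g : G) : S.reducedCrossedProduct →ₗ[ℂ] S.reducedCrossedProduct :=
  LinearMap.mulLeft ℂ (S.inG g) ∘ₗ LinearMap.mulRight ℂ (star (S.inG g))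

variable (S) in
theorem conjG_apply (g : G) (x : S.reducedCrossedProduct) :
    S.conjG g x = S.inG g * (x * star (S.inG g)) := rfl

variable (S) in
theorem norm_conjG_le (g : G) (x : S.reducedCrossedProduct) : ‖S.conjG g x‖ ≤ ‖x‖ := by
  rw [conjG_apply]
  calc _ ≤ ‖S.inG g‖ * (‖x‖ * ‖star (S.inG g)‖) :=
        (norm_mul_le _ _).trans (by gcongr; exact norm_mul_le _ _)
    _ ≤ 1 * (‖x‖ * 1) := by
        rw [norm_star]
        gcongr <;> exact S.norm_inG_le g
    _ = _ := by ring

theorem IsTrivialAction.conjG_inAHom (hS : S.IsTrivialAction) (g : G) (a : A) :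
    S.conjG g (S.inAHom a) = S.inAHom a := by
  rw [conjG_apply, ← mul_assoc, (hS.commute_inG g a).eq, mul_assoc, hS.inG_mul_star_self, mul_one]

theorem IsTrivialAction.isSupportedOn_conjG (hS : S.IsTrivialAction) (g : G) {F : Set G}
    {x : S.reducedCrossedProduct} (hx : IsSupportedOn F x.1) :
    IsSupportedOn {m | ∃ f ∈ F, m = g * f * g⁻¹} (S.conjG g x).1 := by
  refine ((S.isSupportedOn_inG g).mul (hx.mul (hS.isSupportedOn_star_inG g))).mono ?_
  rintro _ ⟨_, rfl, _, ⟨f, hf, _, rfl, rfl⟩, rfl⟩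
  exact ⟨f, hf, (mul_assoc _ _ _).symm⟩

/-! ### Averaging -/

variable (S) in
/-- The properties of convex combinations of the inner automorphisms `x ↦ λ(g) x λ(g)*` that
matter here: they are contractive, fix `A` and leave ideals invariant. -/
structure IsAveraging (Φ : S.reducedCrossedProduct →ₗ[ℂ] S.reducedCrossedProduct) : Prop where
  norm_le : ∀ x, ‖Φ x‖ ≤ ‖x‖
  map_inAHom : ∀ a, Φ (S.inAHom a) = S.inAHom a
  map_mem : ∀ (I : ClosedIdeal S.reducedCrossedProduct), ∀ x ∈ I, Φ x ∈ I

variable (S) in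
theorem isAveraging_id : S.IsAveraging LinearMap.id :=
  ⟨fun _ => le_rfl, fun _ => rfl, fun _ _ hx => hx⟩

theorem IsAveraging.comp {Φ Ψ : S.reducedCrossedProduct →ₗ[ℂ] S.reducedCrossedProduct}
    (hΦ : S.IsAveraging Φ) (hΨ : S.IsAveraging Ψ) : S.IsAveraging (Φ ∘ₗ Ψ) :=
  ⟨fun x => (hΦ.norm_le _).trans (hΨ.norm_le x),
    fun a => by rw [LinearMap.comp_apply, hΨ.map_inAHom, hΦ.map_inAHom],
    fun I x hx => hΦ.map_mem I _ (hΨ.map_mem I x hx)⟩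

variable (S) in
/-- The mean of the automorphisms `x ↦ λ(h j) x λ(h j)*`. -/
noncomputable def average {N : ℕ} (h : Fin N → G) :
    S.reducedCrossedProduct →ₗ[ℂ] S.reducedCrossedProduct :=
  (N : ℂ)⁻¹ • ∑ j, S.conjG (h j)

variable (S) in
theorem average_apply {N : ℕ} (h : Fin N → G) (x : S.reducedCrossedProduct) :
    S.average h x = (N : ℂ)⁻¹ • ∑ j, S.conjG (h j) x := by
  rw [average, LinearMap.smul_apply, LinearMap.sum_apply]

theorem IsTrivialAction.isAveraging_average (hS : S.IsTrivialAction) {N : ℕ} (hN : N ≠ 0)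
    (h : Fin N → G) : S.IsAveraging (S.average h) where
  norm_le x := by
    rw [average_apply, norm_smul, norm_inv, Complex.norm_natCast]
    rw [inv_mul_le_iff₀ (by positivity)]
    refine (norm_sum_le_of_le _ fun j _ => S.norm_conjG_le (h j) x).trans_eq ?_
    simp
  map_inAHom a := by
    have hN' : (N : ℂ) ≠ 0 := by exact_mod_cast hN
    rw [average_apply]
    simp_rw [hS.conjG_inAHom]
    rw [Finset.sum_const, Finset.card_univ, Fintype.card_fin, ← Nat.cast_smul_eq_nsmul ℂ, smul_smul,
      inv_mul_cancel₀ hN', one_smul]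
  map_mem I x hx := by
    rw [average_apply, Algebra.smul_def]
    refine I.mul_mem_left _ (I.toIdeal.sum_mem fun j _ => ?_)
    exact I.mul_mem_left _ (I.mul_mem_right _ hx)

theorem IsTrivialAction.isSupportedOn_average (hS : S.IsTrivialAction) {N : ℕ} (h : Fin N → G)
    {F : Set G} {x : S.reducedCrossedProduct} (hx : IsSupportedOn F x.1) :
    IsSupportedOn {m | ∃ j, ∃ f ∈ F, m = h j * f * (h j)⁻¹} (S.average h x).1 := by
  rw [average_apply]
  change IsSupportedOn {m | ∃ j, ∃ f ∈ F, m = h j * f * (h j)⁻¹}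
    (S.reducedCrossedProduct.subtype ((N : ℂ)⁻¹ • ∑ j, S.conjG (h j) x))
  rw [map_smul, map_sum]
  refine IsSupportedOn.smul (IsSupportedOn.sum fun j _ => ?_) _
  exact (hS.isSupportedOn_conjG (h j) hx).mono fun m hm => ⟨j, hm⟩

open Classical in
/-- Powers averaging: if the sets `T j` are large for the conjugates by `h j` of the support of `x`
and overlap at most `n` times, then the mean over `N` conjugates of `x` has norm `O(1 / √N)`. -/
theorem IsTrivialAction.norm_average_le (hS : S.IsTrivialAction) {N n : ℕ} {h : Fin N → G}
    {T : Fin N → Set G} (hT : ∀ t, (Finset.univ.filter fun j => t ∈ T j).card ≤ n) {F : Set G}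
    (hTF : ∀ j, IsLarge {m | ∃ f ∈ F, m = h j * f * (h j)⁻¹} (T j))
    {x : S.reducedCrossedProduct} (hx : IsSupportedOn F x.1) :
    ‖S.average h x‖ ≤ (N : ℝ)⁻¹ * (2 * (√(n * N) * ‖x‖)) := by
  rw [average_apply, norm_smul, norm_inv, Complex.norm_natCast]
  gcongr
  change ‖S.reducedCrossedProduct.subtype (∑ j, S.conjG (h j) x)‖ ≤ _
  rw [map_sum]
  refine norm_sum_apply_le_of_large hT (norm_nonneg _) (fun j => S.norm_conjG_le _ x)
    fun j ξ hξ t ht => ?_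
  refine hS.isSupportedOn_conjG (h j) hx ξ t fun m hm => hξ _ ?_
  -- largeness: `m⁻¹ t ∉ T j` would give `t = m (m⁻¹ t) ∈ T j`
  by_contra hmt
  refine ht ?_
  simpa using hTF j m hm _ hmt

theorem exists_nat_inv_mul_sqrt_le (n : ℕ) (C : ℝ) {ε : ℝ} (hε : 0 < ε) :
    ∃ N : ℕ, N ≠ 0 ∧ (N : ℝ)⁻¹ * (2 * (√(n * N) * C)) ≤ ε := by
  obtain ⟨N, hN⟩ := exists_nat_ge (4 * n * C ^ 2 / ε ^ 2 + 1)
  have hN0 : (0 : ℝ) < N := lt_of_lt_of_le (by positivity) hN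
  refine ⟨N, by exact_mod_cast hN0.ne', ?_⟩
  rw [inv_mul_le_iff₀ hN0]
  refine le_of_sq_le_sq ?_ (by positivity)
  have h1 : 4 * n * C ^ 2 ≤ ε ^ 2 * N := by
    rw [← div_le_iff₀' (by positivity)]
    linarith
  rw [mul_pow, mul_pow, Real.sq_sqrt (by positivity), mul_pow]
  nlinarith

end TwistedSystem

/-! ### Killing the off-diagonal part by averaging -/

section Groups

open scoped Pointwise

variable {G : Type v} [Group G]

open Classical in
theorem IsPowersSet.exists_large {H F : Set G} (hH : IsPowersSet H F) (N : ℕ) :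
    ∃ (h : Fin N → G) (T : Fin N → Set G), (∀ j, h j ∈ H) ∧
      (∀ t, (Finset.univ.filter fun j => t ∈ T j).card ≤ 1) ∧
      ∀ j, IsLarge {m | ∃ f ∈ F, m = h j * f * (h j)⁻¹} (T j) := by
  obtain ⟨h, T, hh, hT, hl⟩ := hH N
  refine ⟨h, T, hh, fun t => Finset.card_le_one.2 fun i hi j hj => ?_, hl⟩
  by_contra hij
  exact Set.disjoint_left.1 (hT i j hij) (Finset.mem_filter.1 hi).2 (Finset.mem_filter.1 hj).2

open Classical in
/-- For a group with property `(P_com)`, the translates `g₀ʲ (G \ U)` are large for the conjugates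
of `F` by `g₀ʲ`, and every point lies in at most `n` of them since each `D k` is wandering. -/
theorem HasPcom.exists_large (hG : HasPcom G) (F : Finset G) (hF : F.Nonempty) (hF1 : 1 ∉ F) :
    ∃ n : ℕ, ∀ N : ℕ, ∃ (h : Fin N → G) (T : Fin N → Set G),
      (∀ t, (Finset.univ.filter fun j => t ∈ T j).card ≤ n) ∧
      ∀ j, IsLarge {m | ∃ f ∈ (F : Set G), m = h j * f * (h j)⁻¹} (T j) := by
  obtain ⟨n, g, U, D, hUD, hU, hD⟩ := hG F hF hF1
  refine ⟨n, fun N => ⟨fun j => g ^ (j : ℕ), fun j => {t | (g ^ (j : ℕ))⁻¹ * t ∉ U}, fun t => ?_,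
    fun j => ?_⟩⟩
  · have hk : ∀ j : Fin N, (g ^ (j : ℕ))⁻¹ * t ∉ U → ∃ k, (g ^ (j : ℕ))⁻¹ * t ∈ D k :=
      fun j hj => Set.mem_iUnion.1 (hUD hj)
    rcases isEmpty_or_nonempty (Fin n) with hempty | hne
    · refine (Finset.card_eq_zero.2 (Finset.eq_empty_of_forall_notMem fun j hj => ?_)).trans_le
        (Nat.zero_le n)
      exact hempty.elim (hk j (by simpa using hj)).choose
    choose! k hk using hk
    have hlt : ∀ i j : Fin N, i < j → (g ^ (i : ℕ))⁻¹ * t ∉ U → (g ^ (j : ℕ))⁻¹ * t ∉ U →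
        k i ≠ k j := fun i j hij hi hj h => by
      have hij' : (i : ℕ) < j := hij
      have hmem : (g ^ (j : ℕ))⁻¹ * t ∈ ((g ^ ((j : ℕ) - i))⁻¹ • D (k i)) ∩ D (k i) := by
        refine ⟨⟨_, hk i hi, ?_⟩, h ▸ hk j hj⟩
        change (g ^ ((j : ℕ) - i))⁻¹ * ((g ^ (i : ℕ))⁻¹ * t) = _
        rw [← mul_assoc, ← mul_inv_rev, ← pow_add, Nat.add_sub_cancel' hij'.le]
      rw [hD _ (by omega)] at hmem
      exact hmem
    refine (Finset.card_le_card_of_injOn k (t := Finset.univ) (fun _ _ => Finset.mem_univ _)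
      fun i hi j hj h => ?_).trans_eq (Finset.card_fin n)
    have hi' : (g ^ (i : ℕ))⁻¹ * t ∉ U := by simpa using hi
    have hj' : (g ^ (j : ℕ))⁻¹ * t ∉ U := by simpa using hj
    rcases lt_trichotomy i j with hij | hij | hij
    · exact absurd h (hlt i j hij hi' hj')
    · exact hij
    · exact absurd h.symm (hlt j i hij hj' hi')
  · rintro m ⟨f, hf, rfl⟩ t ht
    have ht' : (g ^ (j : ℕ))⁻¹ * t ∈ U := not_not.1 ht
    intro hmem
    have : f * ((g ^ (j : ℕ))⁻¹ * t) ∈ (f • U) ∩ U :=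
      ⟨⟨_, ht', rfl⟩, by simpa [mul_assoc] using hmem⟩
    rw [hU f hf] at this
    exact this

end Groups

namespace TwistedSystem

variable {A : Type u} {G : Type v} [CStarAlgebra A] [Group G] {S : TwistedSystem A G}

variable (S) in
theorem isSupportedOn_inAHom_mul_inG (a : A) (g : G) :
    IsSupportedOn {g} (S.inAHom a * S.inG g).1 :=
  ((S.isSupportedOn_inAHom a).mul (S.isSupportedOn_inG g)).mono (by simp)

variable (S) in
theorem isSupportedOn_finiteSum (a : G →₀ A) :
    IsSupportedOn (a.support : Set G) (S.finiteSum a).1 := by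
  change IsSupportedOn (a.support : Set G)
    (S.reducedCrossedProduct.subtype (∑ g ∈ a.support, S.inAHom (a g) * S.inG g))
  rw [map_sum]
  exact IsSupportedOn.sum fun g hg =>
    (S.isSupportedOn_inAHom_mul_inG (a g) g).mono (Set.singleton_subset_iff.2 hg)

/-- The terms of a finite sum are made small one after the other. Averaging over elements of `K m`
makes the `m`-th term small and only moves the supports of the later terms to other conjugates of
`f i` by finitely many elements of `K i ⊇ K m`. -/
theorem IsTrivialAction.exists_isAveraging_of_chain (hS : S.IsTrivialAction) {n : ℕ} {f : Fin n → G}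
    {K : Fin n → Subgroup G} (hK : Monotone K) (hf : ∀ j, IsCPowersSet (K j : Set G) (f j))
    {x : Fin n → S.reducedCrossedProduct} (hx : ∀ i, IsSupportedOn {f i} (x i).1)
    {ε : ℝ} (hε : 0 < ε) (m : ℕ) (hm : m ≤ n) :
    ∃ Φ, S.IsAveraging Φ ∧ (∀ i : Fin n, (i : ℕ) < m → ‖Φ (x i)‖ ≤ ε) ∧
      ∀ i : Fin n, m ≤ i → ∃ M : Set G, M.Finite ∧ M.Nonempty ∧ M ⊆ K i ∧
        IsSupportedOn (conjBy (f i) M) (Φ (x i)).1 := by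
  induction m with
  | zero =>
    refine ⟨LinearMap.id, S.isAveraging_id, fun i hi => absurd hi (Nat.not_lt_zero _), fun i _ =>
      ⟨{1}, Set.finite_singleton 1, Set.singleton_nonempty 1, by simp, (hx i).mono ?_⟩⟩
    rintro _ rfl
    exact ⟨1, rfl, by simp⟩
  | succ m ih =>
    obtain ⟨Φ, hΦ, hsmall, hsupp⟩ := ih (Nat.le_of_succ_le hm)
    obtain ⟨M, hMf, hMn, hMK, hM⟩ := hsupp ⟨m, hm⟩ le_rfl
    obtain ⟨N, hN, hNε⟩ := exists_nat_inv_mul_sqrt_le 1 ‖Φ (x ⟨m, hm⟩)‖ hε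
    obtain ⟨h, T, hh, hT, hl⟩ := (hf ⟨m, hm⟩ M hMf hMn hMK).exists_large N
    have hav := hS.isAveraging_average hN h
    refine ⟨S.average h ∘ₗ Φ, hav.comp hΦ, fun i hi => ?_, fun i hi => ?_⟩
    · rw [LinearMap.comp_apply]
      rcases Nat.lt_succ_iff_lt_or_eq.1 hi with hi | hi
      · exact (hav.norm_le _).trans (hsmall i hi)
      · obtain rfl : i = ⟨m, hm⟩ := Fin.ext hi
        exact (hS.norm_average_le hT hl hM).trans hNε
    · obtain ⟨M', hMf', ⟨a, ha⟩, hMK', hM'⟩ := hsupp i (Nat.le_of_succ_le hi)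
      have : Nonempty (Fin N) := ⟨⟨0, Nat.pos_of_ne_zero hN⟩⟩
      refine ⟨Set.image2 (· * ·) (Set.range h) M', (Set.finite_range h).image2 _ hMf',
        ⟨_, _, Set.mem_range_self (Classical.arbitrary _), a, ha, rfl⟩, ?_,
        (hS.isSupportedOn_average h hM').mono ?_⟩
      · rintro _ ⟨_, ⟨j, rfl⟩, b, hb, rfl⟩
        exact mul_mem (hK (show (⟨m, hm⟩ : Fin n) ≤ i from Nat.le_of_succ_le hi) (hh j)) (hMK' hb)
      · rintro _ ⟨j, _, ⟨b, hb, rfl⟩, rfl⟩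
        exact ⟨h j * b, ⟨_, ⟨j, rfl⟩, b, hb, rfl⟩, by group⟩

/-- A finite sum without diagonal term can be averaged to an element of arbitrarily small norm. -/
theorem IsTrivialAction.exists_isAveraging_norm_le (hS : S.IsTrivialAction) (hG : InClassP G)
    {a : G →₀ A} (ha : a 1 = 0) {ε : ℝ} (hε : 0 < ε) :
    ∃ Φ, S.IsAveraging Φ ∧ ‖Φ (S.finiteSum a)‖ ≤ ε := by
  rcases a.support.eq_empty_or_nonempty with h0 | hne
  · refine ⟨LinearMap.id, S.isAveraging_id, ?_⟩
    rw [Finsupp.support_eq_empty.1 h0]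
    simpa [finiteSum] using hε.le
  have h1 : 1 ∉ a.support := by simpa using ha
  rcases hG with hG | hG
  · obtain ⟨n, f, K, hf, hfr, hK, hP⟩ := hG a.support hne h1
    have hsum : S.finiteSum a = ∑ i, S.inAHom (a (f i)) * S.inG (f i) := by
      classical
      have himg : a.support = Finset.univ.image f := by
        apply Finset.coe_injective
        rw [← hfr, Finset.coe_image, Finset.coe_univ, Set.image_univ]
      rw [finiteSum, Finsupp.sum, himg, Finset.sum_image hf.injOn]
    obtain ⟨Φ, hΦ, hsmall, -⟩ := hS.exists_isAveraging_of_chain hK hP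
      (fun i => S.isSupportedOn_inAHom_mul_inG (a (f i)) (f i))
      (ε := ε / (n + 1)) (by positivity) n le_rfl
    refine ⟨Φ, hΦ, ?_⟩
    rw [hsum, map_sum]
    refine (norm_sum_le_of_le _ fun i _ => hsmall i i.2).trans ?_
    rw [Finset.sum_const, Finset.card_univ, Fintype.card_fin, nsmul_eq_mul, ← mul_div_assoc,
      div_le_iff₀ (by positivity)]
    nlinarith
  · obtain ⟨n, hn⟩ := hG.exists_large a.support hne h1
    obtain ⟨N, hN, hNε⟩ := exists_nat_inv_mul_sqrt_le n ‖S.finiteSum a‖ hε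
    obtain ⟨h, T, hT, hl⟩ := hn N
    exact ⟨S.average h, hS.isAveraging_average hN h,
      (hS.norm_average_le hT hl (S.isSupportedOn_finiteSum a)).trans hNε⟩

/-! ### The conditional expectation onto `A` -/

section Corner

variable {K : Type u} [NormedAddCommGroup K] [InnerProductSpace ℂ K]

open Classical in
/-- The compression of an operator on `ℓ²(G, K)` to the coordinate `e`. On the reduced crossed
product it is the canonical conditional expectation onto `A`, with `A` acting on `K`. -/
noncomputable def corner (x : EllTwo G K →L[ℂ] EllTwo G K) : K →L[ℂ] K :=
  LinearMap.mkContinuous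
    { toFun := fun v => x (lp.single 2 1 v) 1
      map_add' := fun v w => by rw [lp.single_add, map_add, lp.coeFn_add, Pi.add_apply]
      map_smul' := fun c v => by
        rw [lp.single_smul, map_smul, lp.coeFn_smul, Pi.smul_apply, RingHom.id_apply] }
    ‖x‖ fun v => by
      refine (lp.norm_apply_le_norm two_ne_zero _ _).trans ((x.le_opNorm _).trans_eq ?_)
      rw [lp.norm_single (by norm_num)]

open Classical in
theorem corner_apply (x : EllTwo G K →L[ℂ] EllTwo G K) (v : K) :
    corner x v = x (lp.single 2 1 v) 1 := rfl

theorem norm_corner_le (x : EllTwo G K →L[ℂ] EllTwo G K) : ‖corner x‖ ≤ ‖x‖ := by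
  unfold corner
  exact LinearMap.mkContinuous_norm_le _ (norm_nonneg x) _

theorem corner_sub (x y : EllTwo G K →L[ℂ] EllTwo G K) : corner (x - y) = corner x - corner y := by
  ext1 v
  simp [corner_apply]

theorem corner_eq_zero_of_isSupportedOn {F : Set G} (hF : 1 ∉ F) {x : EllTwo G K →L[ℂ] EllTwo G K}
    (hx : IsSupportedOn F x) : corner x = 0 := by
  classical
  ext1 v
  refine hx _ _ fun f hf => lp.single_apply_ne _ _ _ fun h => hF ?_
  rw [mul_one, inv_eq_one] at h
  exact h ▸ hf

end Corner

variable (S) in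
theorem corner_inAHom (a : A) : corner (S.inAHom a).1 = univRep A (S.α 1⁻¹ a) := by
  classical
  ext1 v
  change S.regA a (lp.single 2 1 v) 1 = _
  rw [regA_apply, lp.single_apply_self]

end TwistedSystem

/-! ### Generated ideals -/

namespace ClosedIdeal

variable {R : Type u} [Ring R] [TopologicalSpace R]

theorem subset_span (s : Set R) : s ⊆ span s := fun _ hx =>
  Submodule.mem_sInf.2 fun _ hI => hI.2.2 hx

theorem span_le {s : Set R} {I : ClosedIdeal R} (h : s ⊆ I) {x : R} (hx : x ∈ span s) : x ∈ I :=
  Submodule.mem_sInf.1 hx I.toIdeal ⟨I.isTwoSided, I.isClosed, h⟩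

end ClosedIdeal

namespace TwistedSystem

variable {A : Type u} {G : Type v} [CStarAlgebra A] [Group G] {S : TwistedSystem A G}

/-! ### The conditional expectation preserves ideals -/

variable (S) in
theorem finiteSum_eq_add_erase (a : G →₀ A) :
    S.finiteSum a = S.inAHom (a 1) + S.finiteSum (a.erase 1) := by
  conv_lhs => rw [← Finsupp.single_add_erase 1 a]
  rw [finiteSum_add, finiteSum_single, inG_one, mul_one]

theorem IsTrivialAction.corner_finiteSum (hS : S.IsTrivialAction) (a : G →₀ A) :
    corner (S.finiteSum a).1 = univRep A (a 1) := by
  have h0 : corner (S.finiteSum (a.erase 1)).1 = 0 :=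
    corner_eq_zero_of_isSupportedOn (by simp) (S.isSupportedOn_finiteSum _)
  have h1 : (S.finiteSum a).1 - (S.inAHom (a 1)).1 = (S.finiteSum (a.erase 1)).1 :=
    congrArg Subtype.val (sub_eq_iff_eq_add'.2 (S.finiteSum_eq_add_erase a))
  rw [← h1, corner_sub, sub_eq_zero, corner_inAHom, hS] at h0
  exact h0

/-- Averaging `x ∈ I` gives an element of `I` close to `A`, namely close to an approximation of the
conditional expectation of `x`. -/
theorem IsTrivialAction.exists_mem_norm_sub_le (hS : S.IsTrivialAction) (hG : InClassP G)
    (I : ClosedIdeal S.reducedCrossedProduct) {x : S.reducedCrossedProduct} (hx : x ∈ I)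
    {ε : ℝ} (hε : 0 < ε) :
    ∃ b : A, ∃ z ∈ I, ‖z - S.inAHom b‖ ≤ ε + ε ∧ ‖corner x.1 - univRep A b‖ ≤ ε := by
  obtain ⟨a, ha⟩ := hS.exists_finiteSum_norm_sub_lt x hε
  obtain ⟨Φ, hΦ, hΦa⟩ := hS.exists_isAveraging_norm_le hG (a := a.erase 1) Finsupp.erase_same hε
  refine ⟨a 1, Φ x, hΦ.map_mem I x hx, ?_, ?_⟩
  · have h : Φ x - S.inAHom (a 1) = Φ (x - S.finiteSum a) + Φ (S.finiteSum (a.erase 1)) := by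
      rw [map_sub, S.finiteSum_eq_add_erase a, map_add, hΦ.map_inAHom]
      abel
    rw [h]
    exact (norm_add_le _ _).trans (add_le_add ((hΦ.norm_le _).trans ha.le) hΦa)
  · rw [← hS.corner_finiteSum, ← corner_sub]
    exact (norm_corner_le _).trans ha.le

/-- The conditional expectation onto `A` maps every closed ideal into itself. -/
theorem IsTrivialAction.exists_inAHom_mem (hS : S.IsTrivialAction) (hG : InClassP G)
    (I : ClosedIdeal S.reducedCrossedProduct) {x : S.reducedCrossedProduct} (hx : x ∈ I) :
    ∃ a : A, S.inAHom a ∈ I ∧ corner x.1 = univRep A a := by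
  have hcl : corner x.1 ∈ closure (Set.range (univRep A)) := Metric.mem_closure_iff.2 fun ε hε => by
    obtain ⟨b, -, -, -, hb⟩ := hS.exists_mem_norm_sub_le hG I hx (half_pos hε)
    exact ⟨_, ⟨b, rfl⟩, by rw [dist_eq_norm]; linarith⟩
  rw [(isClosed_range_univRep A).closure_eq] at hcl
  obtain ⟨a, ha⟩ := hcl
  refine ⟨a, ?_, ha.symm⟩
  rw [← SetLike.mem_coe, show (I : Set S.reducedCrossedProduct) = closure I from
    I.isClosed.closure_eq.symm, Metric.mem_closure_iff]
  intro ε hε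
  obtain ⟨b, z, hz, hzb, hb⟩ := hS.exists_mem_norm_sub_le hG I hx (ε := ε / 4) (by positivity)
  refine ⟨z, hz, ?_⟩
  have h1 : ‖S.inAHom (a - b)‖ ≤ ε / 4 := by
    refine (NonUnitalStarAlgHom.norm_apply_le S.inAHom _).trans ?_
    rwa [← (univRep_isometry A).norm_map_of_map_zero (map_zero _), map_sub, ha]
  rw [dist_eq_norm, show S.inAHom a - z = S.inAHom (a - b) - (z - S.inAHom b) by
    rw [map_sub]; abel]
  linarith [norm_sub_le (S.inAHom (a - b)) (z - S.inAHom b)]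

/-! ### The ideal correspondence -/

variable (S) in
/-- The intersection `I ∩ A` of a closed ideal of the reduced crossed product with `A`. -/
noncomputable def restrictIdeal (I : ClosedIdeal S.reducedCrossedProduct) : ClosedIdeal A where
  toIdeal := I.toIdeal.comap S.inAHom
  isTwoSided := ⟨fun b ha => by
    rw [Ideal.mem_comap] at ha ⊢
    rw [map_mul]
    exact I.mul_mem_right _ ha⟩
  isClosed := I.isClosed.preimage (AddMonoidHomClass.continuous_of_bound S.inAHom 1 fun a => by
    rw [one_mul]
    exact NonUnitalStarAlgHom.norm_apply_le S.inAHom a)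

variable (S) in
theorem mem_restrictIdeal {I : ClosedIdeal S.reducedCrossedProduct} {a : A} :
    a ∈ S.restrictIdeal I ↔ S.inAHom a ∈ I := Iff.rfl

/-- The conditional expectations are compatible with passing to the quotient by `J`. -/
theorem corner_compress {J : ClosedIdeal A}
    {x : EllTwo G (UnivSpace A) →L[ℂ] EllTwo G (UnivSpace A)} {a : A}
    (hx : corner x = univRep A a) : corner (compress J x) = univRep J.Quot (J.quotMap a) := by
  classical
  ext1 v
  have h : ellQuotAdj J G (lp.single 2 1 v)
      = lp.single 2 1 (ContinuousLinearMap.adjoint (univQuot J) v) := by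
    refine lp.ext (funext fun t => ?_)
    change ContinuousLinearMap.adjoint (univQuot J)
      ((lp.single 2 1 v : EllTwo G (UnivSpace J.Quot)) t) = _
    by_cases ht : t = 1
    · subst ht
      rw [lp.single_apply_self, lp.single_apply_self]
    · rw [lp.single_apply_ne _ _ _ ht, lp.single_apply_ne _ _ _ ht, map_zero]
  change univQuot J (x (ellQuotAdj J G (lp.single 2 1 v : EllTwo G (UnivSpace J.Quot))) 1) = _
  rw [h, ← corner_apply, hx, univQuot_intertwine, univQuot_comp_adjoint]

variable (S) in
/-- An operator is zero if all its matrix coefficients vanish, and these are the diagonal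
coefficients at `e` of the operators `λ(l⁻¹) x λ(k)`. -/
theorem eq_zero_of_corner_eq_zero {x : EllTwo G (UnivSpace A) →L[ℂ] EllTwo G (UnivSpace A)}
    (hx : ∀ l k, corner (S.regG l⁻¹ * x * S.regG k) = 0) : x = 0 := by
  classical
  refine lp.ext_continuousLinearMap ENNReal.ofNat_ne_top fun k => ?_
  ext1 v
  change x (lp.single 2 k v) = 0
  refine lp.ext (funext fun l => ?_)
  -- chosen so that `λ(k)` maps `δ_e ⊗ w` to `δ_k ⊗ v`
  set w : UnivSpace A := univRep A (star (S.σ k⁻¹ k : A)) v with hw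
  have h1 : S.regG k (lp.single 2 1 w) = lp.single 2 k v := by
    refine lp.ext (funext fun t => ?_)
    rw [regG_apply]
    by_cases ht : t = k
    · subst ht
      rw [inv_mul_cancel, lp.single_apply_self, lp.single_apply_self, hw, ← mul_apply_eq_comp,
        ← map_mul, Unitary.mul_star_self_of_mem (S.σ t⁻¹ t).2, map_one, one_apply_eq_self]
    · rw [lp.single_apply_ne _ _ _ ht, lp.single_apply_ne _ _ _ fun h => ht ?_, map_zero]
      exact (inv_mul_eq_one.1 h).symm
  have h2 := DFunLike.congr_fun (hx l k) w
  rw [corner_apply, mul_apply_eq_comp, mul_apply_eq_comp, h1, regG_apply] at h2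
  simpa [S.σ_one_left] using h2

/-- For an exact system `⟨J⟩ ∩ A = J`, as the canonical homomorphism restricts to the quotient map
`A → A / J`. -/
theorem IsExact.inAHom_mem_inducedIdeal (hexact : S.IsExact) {J : ClosedIdeal A}
    (hJ : S.IsInvariant J) {a : A} : S.inAHom a ∈ S.inducedIdeal J ↔ a ∈ J := by
  refine ⟨fun h => ?_, fun h => ClosedIdeal.subset_span _ ⟨a, h, rfl⟩⟩
  have h1 := (hexact J hJ _).2 h
  rw [inAHom_apply, canonicalHom_inA, ← inAHom_apply] at h1
  have h2 := (S.quotient hJ).corner_inAHom (J.quotMap a)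
  rw [h1] at h2
  have h3 : univRep J.Quot ((S.quotient hJ).α 1⁻¹ (J.quotMap a)) = 0 := by
    rw [← h2]
    exact norm_le_zero_iff.1 ((norm_corner_le _).trans_eq norm_zero)
  rw [map_eq_zero_iff _ (univRep_injective _), map_eq_zero_iff _ (EquivLike.injective _)] at h3
  exact J.quotMap_eq_zero_iff.1 h3

theorem IsTrivialAction.isInvariant (hS : S.IsTrivialAction) (J : ClosedIdeal A) :
    S.IsInvariant J := fun g a => by rw [hS]

/-- Every closed ideal `I` dies in the quotient system by `J = I ∩ A`: all matrix coefficients of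
its elements are conditional expectations of elements of `I`, hence in `J`. -/
theorem IsTrivialAction.canonicalHom_eq_zero (hS : S.IsTrivialAction) (hG : InClassP G)
    {I : ClosedIdeal S.reducedCrossedProduct} {x : S.reducedCrossedProduct} (hx : x ∈ I) :
    S.canonicalHom (hS.isInvariant (S.restrictIdeal I)) x = 0 := by
  set J := S.restrictIdeal I
  refine Subtype.ext ((S.quotient (hS.isInvariant J)).eq_zero_of_corner_eq_zero fun l k => ?_)
  obtain ⟨a, haI, ha⟩ := hS.exists_inAHom_mem hG I
    (I.mul_mem_right (S.inG k) (I.mul_mem_left (S.inG l⁻¹) hx))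
  have h1 : S.canonicalHom (hS.isInvariant J) (S.inG l⁻¹ * x * S.inG k)
      = (S.quotient (hS.isInvariant J)).inG l⁻¹ * S.canonicalHom (hS.isInvariant J) x
        * (S.quotient (hS.isInvariant J)).inG k := by
    rw [map_mul, map_mul, canonicalHom_inG, canonicalHom_inG]
  refine (congrArg (fun y => corner y.1) h1).symm.trans ((corner_compress ha).trans ?_)
  rw [J.quotMap_eq_zero_iff.2 haI, map_zero]

end TwistedSystem

theorem proposition3p13 {A : Type*} {G : Type*} [CStarAlgebra A] [Group G]
    (S : TwistedSystem A G) (htrivial : S.IsTrivialAction) (hexact : S.IsExact)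
    (hG : InClassP G) :
    Function.Bijective (fun J : ClosedIdeal A => S.inducedIdeal J) := by
  refine ⟨fun J₁ J₂ h => SetLike.ext fun a => ?_, fun I => ⟨S.restrictIdeal I, SetLike.ext fun x =>
    ⟨fun hx => ClosedIdeal.span_le ?_ hx, fun hx => ?_⟩⟩⟩
  · rw [← hexact.inAHom_mem_inducedIdeal (htrivial.isInvariant J₁),
      ← hexact.inAHom_mem_inducedIdeal (htrivial.isInvariant J₂)]
    exact iff_of_eq (congrArg (S.inAHom a ∈ ·) h)
  · rintro _ ⟨a, ha, rfl⟩
    exact S.mem_restrictIdeal.1 ha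
  · exact (hexact _ (htrivial.isInvariant _) x).1 (htrivial.canonicalHom_eq_zero hG hx)
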